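/- **Setting.** Let $R=\Bbbk[x_1,\dots,x_n]$ be a polynomial ring over a field $\Bbbk$ of prime characteristic $p$, let $\alpha\ge 1$, and let $U$ be an $\alpha\times\alpha$ matrix over $R$. For a matrix $X$, $X^{[q]}$ is the matrix of $q$-th powers of its entries. For an ideal $I$, $I^{[p]}$ is the ideal generated by the $p$-th powers of the elements of $I$; for a submodule $K\subseteq R^\alpha$, $K^{[q]}$ is the submodule generated by the vectors $(v_1^q,\dots,v_\alpha^q)^t$, $v\in K$. For a power $q=p^e$, $I_e(K)$ is the smallest submodule $L$ of $R^\alpha$ with $K\subseteq L^{[p^e]}$. For a submodule $V\subseteq R^\alpha$, $V^{\star U}$ is the smallest submodule $K\supseteq V$ with $UK\subseteq K^{[p]}$. An ideal $J$ of $R$ is *$U$-special* if $J=\operatorname{ann}_R(R^\alpha/V)$ for some submodule $V\subseteq R^\alpha$ with $UV\subseteq V^{[p]}$; for $g\in R$, *$g$-special* means special for the $1\times1$ matrix $(g)$. Let $\mathcal K$ be the stable value of the sequence $I_e(U^{[p^{e-1}]}U^{[p^{e-2}]}\cdots U R^\alpha)$, $e\ge1$. A $U$-special prime $Q$ *minimally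 contains* $P$ if $P\subsetneq Q$ and no $U$-special prime lies strictly between $P$ and $Q$. For $a\in R$ and an invertible $\alpha\times\alpha$ matrix $X$ over the localization $R_a$, a *transform of $U$ along $(a,X)$* is a matrix $U_1$ over $R$ with $U_1=a^\nu X^{[p]}UX^{-1}$ over $R_a$ for some $\nu\in\mathbb N$; its top left $(\alpha-1)\times(\alpha-1)$ block is denoted $U_1^\flat$. Let $e_\alpha$ be the last elementary vector. **Theorem.** Let $P$ be a $U$-special prime ideal of $R$ with $\mathcal K\not\subseteq PR^\alpha$. Let $M$ be a matrix whose columns generate $(PR^\alpha)^{\star U}$. 1. If $PR^\alpha\subsetneq\operatorname{im}M$, then for every $U$-special prime $Q$ minimally containing $P$ either * (a) all entries of $M$ are in $Q$, and there is an entry $a\in Q\setminus P$ of $M$ such that $Q$ is a minimal prime of $\operatorname{ann}_R R^\alpha/((P+aR)R^\alpha)^{\star U}$; or * (b) some entry of $M$ is not in $Q$, and for every entry $a\notin Q$ of $M$ the prime $Q$ is special for an $(\alpha-1)\times(\alpha-1)$ matrix, namely: there are an invertible $X$ over $R_a$ with $e_\alpha\in X(\operatorname{im}M)_a$ and a transform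 of $U$ along $(a,X)$; and $Q$ is $U_1^\flat$-special for every such $X$ and every transform $U_1$ of $U$ along $(a,X)$. 2. If $PR^\alpha=\operatorname{im}M$, then there are $a_1\in R\setminus P$, $g\in(P^{[p]}:P)\setminus P^{[p]}$ and $\mu_0\in\mathbb N$ such that for every $\mu\ge\mu_0$ there is an $\alpha\times\alpha$ matrix $V$ over $R$ with $a_1^\mu U\equiv gV$ modulo $P^{[p]}$; and for all $\mu\ge\mu_0$, all such $V$, with $d=\det V$, and all $U$-special primes $Q$ minimally containing $P$, one of the following holds: * (a) $d\in P$, and $Q$ is special for an $(\alpha-1)\times(\alpha-1)$ matrix of the form $U_1^\flat$, where $U_1$ is a transform of $U$ along some $(a,X)$ with $a\notin Q$. More precisely, call $(a,X,U_1)$, with $U_1$ a transform of $U$ along $(a,X)$, of *type A* if the last column of $VX^{-1}$ is zero modulo $PR_a$, and of *type B* if $e_\alpha\in X\mathcal K_a$. Then triples of type A with $a\notin P$ and triples of type B with $a\notin P$ exist; either $Q$ is $U_1^\flat$-special for all triples of type A with $a\notin Q$, or $Q$ is $U_1^\flat$-special for all triples of type B with $a\notin Q$; and for every $a\in Q\setminus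 P$, $Q$ is a minimal prime of $\operatorname{ann}_R R^\alpha/((P+aR)R^\alpha)^{\star U}$. * (b) $d\in Q\setminus P$, and $Q$ is a minimal prime of $\operatorname{ann}_R R^\alpha/((P+dR)R^\alpha)^{\star U}$. * (c) $d\notin Q$, and $Q$ is a $g$-special ideal of $R$. -/

import Mathlib

open Matrix

namespace SpecialIdeals

section Basic

variable {R : Type*} [CommRing R] {r : ℕ}

/-- The Frobenius power `I^[q]` of an ideal: the ideal generated by the `q`-th powers of its
elements. -/
def idealFrobPow (q : ℕ) (I : Ideal R) : Ideal R :=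
  Ideal.span ((fun x : R => x ^ q) '' (I : Set R))

/-- The Frobenius power `K^[q]` of a submodule of `R^r`: the submodule generated by the vectors
`(v_1^q, …, v_r^q)` with `v ∈ K`. -/
def frobPow (q : ℕ) (K : Submodule R (Fin r → R)) : Submodule R (Fin r → R) :=
  Submodule.span R ((fun (v : Fin r → R) (i : Fin r) => v i ^ q) '' (K : Set (Fin r → R)))

/-- `U K ⊆ K^[p]`. -/
def IsCompatible (p : ℕ) (U : Matrix (Fin r) (Fin r) R) (K : Submodule R (Fin r → R)) : Prop :=
  K.map U.mulVecLin ≤ frobPow p K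

/-- `J` is `U`-special: it is the annihilator of `R^r / V` for some submodule `V` of `R^r` with
`U V ⊆ V^[p]`. -/
def IsSpecial (p : ℕ) (U : Matrix (Fin r) (Fin r) R) (J : Ideal R) : Prop :=
  ∃ V : Submodule R (Fin r → R),
    IsCompatible p U V ∧ J = Module.annihilator R ((Fin r → R) ⧸ V)

/-- A `U`-special prime ideal. -/
def IsSpecialPrime (p : ℕ) (U : Matrix (Fin r) (Fin r) R) (J : Ideal R) : Prop :=
  J.IsPrime ∧ IsSpecial p U J

/-- `Q` is a `U`-special prime minimally containing `P`: it contains `P` strictly and no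
`U`-special prime lies strictly between them. -/
def MinimallyContains (p : ℕ) (U : Matrix (Fin r) (Fin r) R) (P Q : Ideal R) : Prop :=
  IsSpecialPrime p U Q ∧ P < Q ∧
    ∀ Q' : Ideal R, IsSpecialPrime p U Q' → ¬ (P < Q' ∧ Q' < Q)

/-- The star closure `V^{⋆U}`: the smallest submodule `K` containing `V` with `U K ⊆ K^[p]`. -/
def starClosure (p : ℕ) (U : Matrix (Fin r) (Fin r) R) (V : Submodule R (Fin r → R)) :
    Submodule R (Fin r → R) :=
  sInf {K | V ≤ K ∧ IsCompatible p U K}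

/-- `I_e(K)` for `q = p ^ e`: the smallest submodule `L` with `K ⊆ L^[q]`. -/
def rootModule (q : ℕ) (K : Submodule R (Fin r → R)) : Submodule R (Fin r → R) :=
  sInf {L | K ≤ frobPow q L}

/-- `U^[p^(e-1)] U^[p^(e-2)] ⋯ U^[p] U`, where `U^[q]` has the `q`-th powers of the entries. -/
def frobIter (p : ℕ) (U : Matrix (Fin r) (Fin r) R) : ℕ → Matrix (Fin r) (Fin r) R
  | 0 => 1
  | e + 1 => U.map (fun x => x ^ p ^ e) * frobIter p U e

/-- The submodule `I_e(U^[p^(e-1)] ⋯ U R^r)`. -/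
def iterImage (p : ℕ) (U : Matrix (Fin r) (Fin r) R) (e : ℕ) : Submodule R (Fin r → R) :=
  rootModule (p ^ e) (LinearMap.range (frobIter p U e).mulVecLin)

/-- The stable value `𝒦` of the sequence `I_e(U^[p^(e-1)] ⋯ U R^r)`. It is written as a lower limit
in the lattice of submodules, which is the stable value of any eventually constant sequence. -/
def stableImage (p : ℕ) (U : Matrix (Fin r) (Fin r) R) : Submodule R (Fin r → R) :=
  Filter.liminf (iterImage p U) Filter.atTop

theorem stableImage_eq_of_eventually (p : ℕ) (U : Matrix (Fin r) (Fin r) R)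
    (K : Submodule R (Fin r → R)) (h : ∀ᶠ e in Filter.atTop, iterImage p U e = K) :
    stableImage p U = K := by
  unfold stableImage
  rw [Filter.liminf_congr h, Filter.liminf_const]

/-- `ann_R (R^r / ((P + aR) R^r)^{⋆U})`. -/
def annStar (p : ℕ) (U : Matrix (Fin r) (Fin r) R) (P : Ideal R) (a : R) : Ideal R :=
  Module.annihilator R ((Fin r → R) ⧸
    starClosure p U ((P ⊔ Ideal.span {a}) • (⊤ : Submodule R (Fin r → R))))

/-- The extension `N_a` of a submodule `N` of `R^r` to a submodule of `R_a^r`. -/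
def extendAway (a : R) (N : Submodule R (Fin r → R)) :
    Submodule (Localization.Away a) (Fin r → Localization.Away a) :=
  Submodule.span (Localization.Away a)
    ((fun (v : Fin r → R) (i : Fin r) => algebraMap R (Localization.Away a) (v i)) ''
      (N : Set (Fin r → R)))

/-- `U₁` has entries in `R` and equals `a^ν X^[p] U X⁻¹` over `R_a`, for some `ν`. -/
def IsTransform (p : ℕ) (U : Matrix (Fin r) (Fin r) R) (a : R)
    (X : GL (Fin r) (Localization.Away a)) (U₁ : Matrix (Fin r) (Fin r) R) : Prop :=
  ∃ ν : ℕ, U₁.map (algebraMap R (Localization.Away a)) =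
    algebraMap R (Localization.Away a) a ^ ν •
      ((X : Matrix (Fin r) (Fin r) (Localization.Away a)).map (fun x => x ^ p) *
        U.map (algebraMap R (Localization.Away a)) *
        ((X⁻¹ : GL (Fin r) (Localization.Away a)) :
          Matrix (Fin r) (Fin r) (Localization.Away a)))

end Basic

section Block

variable {R : Type*} [CommRing R] {m : ℕ}

/-- The top left `m × m` submatrix of an `(m+1) × (m+1)` matrix. -/
def leadingBlock (U : Matrix (Fin (m + 1)) (Fin (m + 1)) R) : Matrix (Fin m) (Fin m) R :=
  U.submatrix Fin.castSucc Fin.castSucc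

/-- `X N_a` contains the last elementary vector of `R_a^(m+1)`. -/
def MovesLastInto (a : R) (X : GL (Fin (m + 1)) (Localization.Away a))
    (N : Submodule R (Fin (m + 1) → R)) : Prop :=
  ∃ v ∈ extendAway a N,
    (X : Matrix (Fin (m + 1)) (Fin (m + 1)) (Localization.Away a)) *ᵥ v =
      Pi.single (Fin.last m) 1

/-- The last column of `V X⁻¹` is zero modulo `P R_a`. -/
def KillsLastColumn (a : R) (X : GL (Fin (m + 1)) (Localization.Away a))
    (V : Matrix (Fin (m + 1)) (Fin (m + 1)) R) (P : Ideal R) : Prop :=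
  ∀ i, (V.map (algebraMap R (Localization.Away a)) *
      ((X⁻¹ : GL (Fin (m + 1)) (Localization.Away a)) :
        Matrix (Fin (m + 1)) (Fin (m + 1)) (Localization.Away a))) i (Fin.last m) ∈
    P.map (algebraMap R (Localization.Away a))

end Block

end SpecialIdeals

namespace SpecialIdeals

/-! Everything rests on flatness of the Frobenius, in explicit form: `R` has p⁻¹-linear coordinates,
and a vector lies in W^[p] iff all its coordinate vectors lie in W
(`IsFrobeniusCoordinates.mem_frobPow_iff`). Hence Frobenius powers commute with intersections,
colons, preimages and saturations. So star closures are compatible, minimal primes of special ideals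
are special, and a special prime Q is the annihilator of R^α/W for a compatible W saturated with
respect to R∖Q (`IsSpecialPrime.exists_saturated`).

Let Q minimally contain P. If a ∈ Q∖P, some minimal prime of `annStar p U P a` lies in Q; it is
special and strictly contains P, so it is Q (`MinimallyContains.mem_minimalPrimes_annStar`). This
gives every minimal-prime claim. If a ∉ Q and X moves a vector of W to e_α, then transporting W
along X and dropping the last coordinate keeps the annihilator and is compatible with the leading
block (`MovesLastInto.isSpecial_leadingBlock`). For 1(b), im M ⊆ W supplies the vector.

In part 2 the module (P^[p] : P)/P^[p] is generically generated by one g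
(`HasFrobeniusGenerators.polynomial`), whence U ≡ gV up to a multiplier. If det V ∉ Q, multiplying
by the adjugate shows gQ ⊆ Q^[p]. If det V ∈ P, then V has a kernel vector modulo P, which U sends
into P^[p]. When U R^α ⊄ W^[p], that vector can be added to W without enlarging the annihilator
(type A); when U R^α ⊆ W^[p], the stable image lies in W (type B). -/

/-- Coordinates of `R` over itself via the Frobenius: `c x` is `p⁻¹`-linear in `x` and is a coordinate
vector of `x` with respect to the family `b`. -/
def IsFrobeniusCoordinates (p : ℕ) {R ι : Type*} [CommRing R] (b : ι → R) (c : R →+ (ι →₀ R)) :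
    Prop :=
  (∀ r x, c (r ^ p * x) = r • c x) ∧ ∀ x, (c x).sum (fun i y => y ^ p * b i) = x

/-! ### Frobenius coordinates on fields and polynomial rings. -/

section Coordinates

universe u

/-- `R` has a family of coordinates over itself via the Frobenius. -/
def HasFrobeniusCoordinates (p : ℕ) (R : Type u) [CommRing R] : Prop :=
  ∃ (ι : Type u) (b : ι → R) (c : R →+ (ι →₀ R)), IsFrobeniusCoordinates p b c

/-- `V` stands for k with scalars acting through p-th powers; a separate type keeps the two actions
apart. The coordinates come from a vector space basis. -/
theorem hasFrobeniusCoordinates_of_module {p : ℕ} {k : Type u} [Field k] {V : Type u}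
    [AddCommGroup V] [Module k V] (e : V ≃+ k) (he : ∀ (r : k) v, e (r • v) = r ^ p * e v) :
    HasFrobeniusCoordinates p k := by
  let B := Module.Basis.ofVectorSpace k V
  refine ⟨_, fun i => e (B i), B.repr.toAddEquiv.toAddMonoidHom.comp e.symm.toAddMonoidHom, ?_, ?_⟩
  · intro r x
    have : e.symm (r ^ p * x) = r • e.symm x := by
      apply e.injective
      simp [he]
    simp [this]
  · intro x
    have h := congrArg e (B.linearCombination_repr (e.symm x))
    rw [Finsupp.linearCombination_apply, Finsupp.sum, map_sum] at h
    simpa [he, Finsupp.sum] using h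

theorem hasFrobeniusCoordinates_field (p : ℕ) [Fact p.Prime] (k : Type u) [Field k] [CharP k p] :
    HasFrobeniusCoordinates p k :=
  @hasFrobeniusCoordinates_of_module p k _ k _ (Module.compHom k (frobenius k p))
    (AddEquiv.refl k) fun _ _ => rfl

theorem HasFrobeniusCoordinates.of_ringEquiv {p : ℕ} [Fact p.Prime] {A B : Type u}
    [CommRing A] [CommRing B] (e : A ≃+* B) (h : HasFrobeniusCoordinates p A) : HasFrobeniusCoordinates p B := by
  obtain ⟨ι, b, c, h1, h2⟩ := h
  refine ⟨ι, fun i => e (b i), (Finsupp.mapRange.addMonoidHom (e : A →+ B)).comp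
    (c.comp (e.symm : B →+ A)), ?_, ?_⟩
  · intro r x
    ext i
    simp [h1]
  · intro x
    have h := congrArg e (h2 (e.symm x))
    rw [Finsupp.sum, map_sum] at h
    rw [AddMonoidHom.comp_apply, Finsupp.mapRange.addMonoidHom_apply, Finsupp.sum_mapRange_index
      (by simp [(Fact.out : p.Prime).ne_zero])]
    simpa [Finsupp.sum] using h

section Polynomial

open Polynomial

variable {A ι : Type*} [CommRing A]

/-- The coordinates of the monomials of degree `n`, as a function of those of the coefficient. -/
noncomputable def monomialCoordinates (A ι : Type*) [CommRing A] (p n : ℕ) :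
    (ι →₀ A) →+ (ι × ℕ →₀ A[X]) :=
  Finsupp.liftAddHom fun i =>
    (Finsupp.singleAddHom (i, n % p)).comp (monomial (n / p)).toAddMonoidHom

@[simp]
theorem monomialCoordinates_single (p n : ℕ) (i : ι) (y : A) :
    monomialCoordinates A ι p n (Finsupp.single i y) =
      Finsupp.single (i, n % p) (monomial (n / p) y) := by
  simp [monomialCoordinates]

/-- Frobenius coordinates of a polynomial. -/
noncomputable def polynomialCoordinates (p : ℕ) (c : A →+ (ι →₀ A)) :
    A[X] →+ (ι × ℕ →₀ A[X]) where
  toFun f := f.sum fun n a => monomialCoordinates A ι p n (c a)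
  map_zero' := by simp
  map_add' f g := Polynomial.sum_add_index f g _ (by simp) (by simp)

@[simp]
theorem polynomialCoordinates_monomial (p : ℕ) (c : A →+ (ι →₀ A)) (n : ℕ) (a : A) :
    polynomialCoordinates p c (monomial n a) = monomialCoordinates A ι p n (c a) :=
  Polynomial.sum_monomial_index a (fun n a => monomialCoordinates A ι p n (c a)) (by simp)

/-- If a = ∑ yᵢ^p bᵢ, then a X^n = ∑ (yᵢ X^(n/p))^p bᵢ X^(n%p). Indices with second component ≥ p
are never used, which is harmless because independence of the family is not required. -/
theorem IsFrobeniusCoordinates.polynomial {p : ℕ} [Fact p.Prime] [CharP A p] {b : ι → A}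
    {c : A →+ (ι →₀ A)} (h : IsFrobeniusCoordinates p b c) :
    IsFrobeniusCoordinates p (fun i : ι × ℕ => monomial i.2 (b i.1))
      (polynomialCoordinates p c) := by
  have hp : 0 < p := (Fact.out : p.Prime).pos
  constructor
  · intro r x
    induction r using Polynomial.induction_on' with
    | add r s hr hs => rw [add_pow_char, add_mul, map_add, hr, hs, add_smul]
    | monomial l s =>
      induction x using Polynomial.induction_on' with
      | add x y hx hy => rw [mul_add, map_add, hx, hy, map_add, smul_add]
      | monomial n a =>
        rw [monomial_pow, monomial_mul_monomial, polynomialCoordinates_monomial,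
          polynomialCoordinates_monomial, h.1]
        induction c a using Finsupp.induction_linear with
        | zero => simp
        | add f g hf hg => rw [smul_add, map_add, hf, hg, map_add, smul_add]
        | single i y =>
          rw [Finsupp.smul_single, monomialCoordinates_single, monomialCoordinates_single,
            Finsupp.smul_single, Nat.mul_comm l p, Nat.mul_add_mod, Nat.mul_add_div hp,
            smul_eq_mul, smul_eq_mul, monomial_mul_monomial]
  · intro x
    have key : ∀ u v : ι × ℕ →₀ A[X],
        (u + v).sum (fun i y => y ^ p * monomial i.2 (b i.1)) =
          u.sum (fun i y => y ^ p * monomial i.2 (b i.1)) +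
            v.sum (fun i y => y ^ p * monomial i.2 (b i.1)) := fun u v =>
      Finsupp.sum_add_index' (by simp [hp.ne']) (by simp [add_pow_char, add_mul])
    induction x using Polynomial.induction_on' with
    | add x y hx hy => rw [map_add, key, hx, hy]
    | monomial n a =>
      rw [polynomialCoordinates_monomial]
      conv_rhs => rw [← h.2 a]
      induction c a using Finsupp.induction_linear with
      | zero => simp
      | add f g hf hg =>
        rw [map_add, key, hf, hg, Finsupp.sum_add_index' (by simp [hp.ne'])
          (by simp [add_pow_char, add_mul]), map_add]
      | single i y =>
        rw [monomialCoordinates_single, Finsupp.sum_single_index (by simp [hp.ne']),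
          Finsupp.sum_single_index (by simp [hp.ne'])]
        simp [monomial_pow, monomial_mul_monomial, Nat.div_add_mod']

theorem HasFrobeniusCoordinates.polynomial {p : ℕ} [Fact p.Prime] {A : Type u} [CommRing A]
    [CharP A p] (h : HasFrobeniusCoordinates p A) : HasFrobeniusCoordinates p A[X] := by
  obtain ⟨ι, b, c, h⟩ := h
  exact ⟨_, _, _, h.polynomial⟩

end Polynomial

end Coordinates

/-! ### Frobenius powers read off coordinatewise. -/

section FrobPow

variable {R : Type*} [CommRing R] {r : ℕ}

theorem mem_smul_top_iff (I : Ideal R) (v : Fin r → R) :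
    v ∈ I • (⊤ : Submodule R (Fin r → R)) ↔ ∀ i, v i ∈ I := by
  constructor
  · intro h i
    refine Submodule.smul_induction_on h (fun a ha n _ => ?_) (fun x y hx hy => ?_)
    · exact I.mul_mem_right _ ha
    · exact I.add_mem hx hy
  · intro h
    rw [pi_eq_sum_univ' v]
    exact Submodule.sum_mem _ fun i _ => Submodule.smul_mem_smul (h i) trivial

theorem smul_top_le_iff (I : Ideal R) (W : Submodule R (Fin r → R)) :
    I • (⊤ : Submodule R (Fin r → R)) ≤ W ↔ I ≤ Module.annihilator R ((Fin r → R) ⧸ W) := by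
  rw [Submodule.annihilator_quotient, Submodule.smul_le]
  simp [SetLike.le_def, Submodule.mem_colon]

theorem mem_annihilator_quotient_iff (W : Submodule R (Fin r → R)) (x : R) :
    x ∈ Module.annihilator R ((Fin r → R) ⧸ W) ↔ ∀ v, x • v ∈ W := by
  simp [Submodule.annihilator_quotient, Submodule.mem_colon]

theorem pow_mem_idealFrobPow (q : ℕ) {I : Ideal R} {x : R} (hx : x ∈ I) :
    x ^ q ∈ idealFrobPow q I :=
  Ideal.subset_span ⟨x, hx, rfl⟩

theorem frobPow_mono (q : ℕ) {K L : Submodule R (Fin r → R)} (h : K ≤ L) :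
    frobPow q K ≤ frobPow q L :=
  Submodule.span_mono (Set.image_mono h)

theorem idealFrobPow_mono (q : ℕ) {I J : Ideal R} (h : I ≤ J) :
    idealFrobPow q I ≤ idealFrobPow q J :=
  Ideal.span_mono (Set.image_mono h)

theorem idealFrobPow_le_self {q : ℕ} (hq : q ≠ 0) (I : Ideal R) : idealFrobPow q I ≤ I := by
  refine Ideal.span_le.2 ?_
  rintro _ ⟨x, hx, rfl⟩
  exact I.pow_mem_of_mem hx q (Nat.pos_of_ne_zero hq)

theorem map_mem_idealFrobPow {S : Type*} [CommRing S] (q : ℕ) (φ : R →+* S) {I : Ideal R}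
    {J : Ideal S} (h : ∀ x ∈ I, φ x ∈ J) {x : R} (hx : x ∈ idealFrobPow q I) :
    φ x ∈ idealFrobPow q J := by
  refine (Ideal.span_le (I := (idealFrobPow q J).comap φ)).2 ?_ hx
  rintro _ ⟨y, hy, rfl⟩
  simpa using pow_mem_idealFrobPow q (h y hy)

variable {p : ℕ} {U : Matrix (Fin r) (Fin r) R}

theorem isCompatible_iff {K : Submodule R (Fin r → R)} :
    IsCompatible p U K ↔ ∀ v ∈ K, U *ᵥ v ∈ frobPow p K := by
  simp [IsCompatible, SetLike.le_def]

theorem le_starClosure (V : Submodule R (Fin r → R)) : V ≤ starClosure p U V :=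
  le_sInf fun _ hK => hK.1

theorem starClosure_le {V K : Submodule R (Fin r → R)} (h : V ≤ K) (hK : IsCompatible p U K) :
    starClosure p U V ≤ K :=
  sInf_le ⟨h, hK⟩

variable {ι : Type*} {b : ι → R} {c : R →+ (ι →₀ R)}

/-- Coordinatewise description of the Frobenius power of a submodule. -/
theorem IsFrobeniusCoordinates.mem_frobPow_iff [Fact p.Prime] (h : IsFrobeniusCoordinates p b c)
    {W : Submodule R (Fin r → R)} {v : Fin r → R} :
    v ∈ frobPow p W ↔ ∀ j, (fun i => c (v i) j) ∈ W := by
  have hp : p ≠ 0 := (Fact.out : p.Prime).ne_zero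
  constructor
  · intro hv j
    induction hv using Submodule.span_induction with
    | mem x hx =>
      obtain ⟨w, hw, rfl⟩ := hx
      have : (fun i => c (w i ^ p) j) = c 1 j • w := by
        ext i
        have := h.1 (w i) 1
        rw [mul_one] at this
        simp [this, mul_comm]
      simpa only [this] using W.smul_mem _ hw
    | zero =>
      convert W.zero_mem using 1
      ext i
      simp
    | add x y _ _ hx hy =>
      convert W.add_mem hx hy using 1
      ext i
      simp
    | smul a x hx _ =>
      -- An arbitrary scalar does not pass through `c`, so a second induction runs with `a` general;
      -- on generators the j-th coordinate of a·w^p is (c a)_j · w.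
      clear * - hx h
      induction hx using Submodule.span_induction generalizing a with
      | mem x hx =>
        obtain ⟨w, hw, rfl⟩ := hx
        have : (fun i => c ((a • fun i => w i ^ p) i) j) = c a j • w := by
          ext i
          have := h.1 (w i) a
          simp [mul_comm a, this, mul_comm (w i)]
        simpa only [this] using W.smul_mem _ hw
      | zero =>
        convert W.zero_mem using 1
        ext i
        simp
      | add x y _ _ hx hy =>
        convert W.add_mem (hx a) (hy a) using 1
        ext i
        simp [mul_add]
      | smul d x _ hx => simpa only [smul_smul] using hx (a * d)
  · intro hv
    classical
    let T : Finset ι := Finset.univ.biUnion fun i => (c (v i)).support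
    have : v = ∑ j ∈ T, b j • fun i => c (v i) j ^ p := by
      ext i
      conv_lhs => rw [← h.2 (v i)]
      rw [Finsupp.sum_of_support_subset (s := T)]
      · simp [mul_comm]
      · exact Finset.subset_biUnion_of_mem (fun i => (c (v i)).support) (Finset.mem_univ i)
      · simp [hp]
    rw [this]
    exact Submodule.sum_mem _ fun j _ => Submodule.smul_mem _ _ <|
      Submodule.subset_span ⟨_, hv j, rfl⟩

theorem IsFrobeniusCoordinates.mem_idealFrobPow_iff [Fact p.Prime]
    (h : IsFrobeniusCoordinates p b c) {I : Ideal R} {x : R} :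
    x ∈ idealFrobPow p I ↔ ∀ j, c x j ∈ I := by
  have hp : p ≠ 0 := (Fact.out : p.Prime).ne_zero
  constructor
  · intro hx j
    induction hx using Submodule.span_induction generalizing j with
    | mem x hx =>
      obtain ⟨w, hw, rfl⟩ := hx
      have := h.1 w 1
      rw [mul_one] at this
      simpa [this] using I.mul_mem_right _ hw
    | zero => simp
    | add x y _ _ hx hy => simpa using I.add_mem (hx j) (hy j)
    | smul a x hx _ =>
      clear * - hx h
      induction hx using Submodule.span_induction generalizing a with
      | mem x hx =>
        obtain ⟨w, hw, rfl⟩ := hx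
        have := h.1 w a
        simpa [mul_comm a, this] using I.mul_mem_right _ hw
      | zero => simp
      | add x y _ _ hx hy => simpa [mul_add] using I.add_mem (hx a) (hy a)
      | smul d x _ hx => simpa [mul_assoc] using hx (a * d)
  · intro hx
    rw [← h.2 x]
    exact Ideal.sum_mem _ fun j _ => Ideal.mul_mem_right _ _ (pow_mem_idealFrobPow p (hx j))

end FrobPow

/-! ### Consequences of flatness: compatible submodules and special primes. -/

section Coordinates

universe u
variable {R : Type u} [CommRing R] {r s : ℕ} {p : ℕ} [Fact p.Prime]

theorem mem_frobPow_smul_top_iff (hR : HasFrobeniusCoordinates p R) {I : Ideal R}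
    {v : Fin r → R} :
    v ∈ frobPow p (I • (⊤ : Submodule R (Fin r → R))) ↔ ∀ i, v i ∈ idealFrobPow p I := by
  obtain ⟨ι, b, c, h⟩ := hR
  simp only [h.mem_frobPow_iff, h.mem_idealFrobPow_iff, mem_smul_top_iff]
  exact forall_comm

/-- Passing from a to a^p lets the multiplier come out of the coordinates as a, where primality of P
applies. -/
theorem mem_idealFrobPow_of_mul_mem (hR : HasFrobeniusCoordinates p R) {P : Ideal R}
    (hP : P.IsPrime) {a x : R} (ha : a ∉ P) (hx : a * x ∈ idealFrobPow p P) :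
    x ∈ idealFrobPow p P := by
  obtain ⟨ι, b, c, h⟩ := hR
  have hp : p ≠ 0 := (Fact.out : p.Prime).ne_zero
  have hx' : a ^ p * x ∈ idealFrobPow p P := by
    obtain ⟨q, rfl⟩ := Nat.exists_eq_succ_of_ne_zero hp
    rw [pow_succ, mul_assoc]
    exact Ideal.mul_mem_left _ _ hx
  rw [h.mem_idealFrobPow_iff] at hx' ⊢
  intro j
  have := hx' j
  rw [h.1] at this
  exact (hP.mem_or_mem this).resolve_left ha

theorem mem_frobPow_of_smul (hR : HasFrobeniusCoordinates p R) {W : Submodule R (Fin r → R)}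
    {a : R} (hW : ∀ w, a • w ∈ W → w ∈ W) {v : Fin r → R} (hv : a • v ∈ frobPow p W) :
    v ∈ frobPow p W := by
  obtain ⟨ι, b, c, h⟩ := hR
  have hp : p ≠ 0 := (Fact.out : p.Prime).ne_zero
  have hv' : a ^ p • v ∈ frobPow p W := by
    obtain ⟨q, rfl⟩ := Nat.exists_eq_succ_of_ne_zero hp
    rw [pow_succ, mul_smul]
    exact Submodule.smul_mem _ _ hv
  rw [h.mem_frobPow_iff] at hv' ⊢
  intro j
  refine hW _ ?_
  convert hv' j using 1
  ext i
  simp [h.1]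

/-- The coordinate vectors of x·eᵢ are the coordinates of x times eᵢ, so each coordinate of x sends
every eᵢ into W. -/
theorem mem_idealFrobPow_annihilator (hR : HasFrobeniusCoordinates p R)
    {W : Submodule R (Fin r → R)} {x : R} (hx : ∀ v : Fin r → R, x • v ∈ frobPow p W) :
    x ∈ idealFrobPow p (Module.annihilator R ((Fin r → R) ⧸ W)) := by
  obtain ⟨ι, b, c, h⟩ := hR
  rw [h.mem_idealFrobPow_iff]
  intro j
  rw [mem_annihilator_quotient_iff]
  intro v
  rw [pi_eq_sum_univ' v, Finset.smul_sum]
  refine Submodule.sum_mem _ fun i _ => ?_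
  rw [smul_comm]
  refine W.smul_mem _ ?_
  convert h.mem_frobPow_iff.1 (hx (Pi.single i 1)) j using 1
  ext l
  rcases eq_or_ne l i with rfl | hl
  · simp
  · simp [hl]

theorem mem_frobPow_comap_iff (hR : HasFrobeniusCoordinates p R) {W : Submodule R (Fin s → R)}
    (Z : Matrix (Fin s) (Fin r) R) {v : Fin r → R} :
    v ∈ frobPow p (W.comap Z.mulVecLin) ↔ Z.map (fun x => x ^ p) *ᵥ v ∈ frobPow p W := by
  obtain ⟨ι, b, c, h⟩ := hR
  rw [h.mem_frobPow_iff, h.mem_frobPow_iff]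
  refine forall_congr' fun j => ?_
  rw [Submodule.mem_comap]
  convert Iff.rfl using 2
  ext i
  simp [mulVec, dotProduct, map_sum, h.1, Finsupp.finsetSum_apply]

theorem mem_frobPow_sInf (hR : HasFrobeniusCoordinates p R)
    (S : Set (Submodule R (Fin r → R))) {v : Fin r → R} (hv : ∀ K ∈ S, v ∈ frobPow p K) :
    v ∈ frobPow p (sInf S) := by
  obtain ⟨ι, b, c, h⟩ := hR
  rw [h.mem_frobPow_iff]
  intro j
  rw [Submodule.mem_sInf]
  exact fun K hK => h.mem_frobPow_iff.1 (hv K hK) j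

variable {U : Matrix (Fin r) (Fin r) R}

theorem isCompatible_starClosure (hR : HasFrobeniusCoordinates p R)
    (V : Submodule R (Fin r → R)) : IsCompatible p U (starClosure p U V) := by
  rw [isCompatible_iff]
  intro v hv
  refine mem_frobPow_sInf hR _ fun K hK => ?_
  exact isCompatible_iff.1 hK.2 v (Submodule.mem_sInf.1 hv K hK)

/-- Since a^p·Uv = a^(p-1)·U(av) ∈ K^[p], the coordinate vectors of Uv are sent into K by a. Letting
a depend on v covers both colons by an element and saturations. -/
theorem isCompatible_of_forall_exists_smul (hR : HasFrobeniusCoordinates p R)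
    {K L : Submodule R (Fin r → R)} (hK : IsCompatible p U K)
    (h : ∀ v ∈ L, ∃ a : R, a • v ∈ K ∧ ∀ w, a • w ∈ K → w ∈ L) : IsCompatible p U L := by
  rw [isCompatible_iff] at hK ⊢
  intro v hv
  obtain ⟨a, hav, ha⟩ := h v hv
  have hp : p ≠ 0 := (Fact.out : p.Prime).ne_zero
  have hv' : a ^ p • U *ᵥ v ∈ frobPow p K := by
    obtain ⟨q, rfl⟩ := Nat.exists_eq_succ_of_ne_zero hp
    rw [pow_succ, mul_smul, ← mulVec_smul]
    exact Submodule.smul_mem _ _ (hK _ hav)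
  obtain ⟨ι, b, c, hc⟩ := hR
  rw [hc.mem_frobPow_iff] at hv' ⊢
  intro j
  refine ha _ ?_
  convert hv' j using 1
  ext i
  simp [hc.1]

theorem IsSpecial.colon_singleton (hR : HasFrobeniusCoordinates p R) {J : Ideal R}
    (hJ : IsSpecial p U J) (a : R) : IsSpecial p U (J.colon {a}) := by
  obtain ⟨K, hK, rfl⟩ := hJ
  refine ⟨K.comap (LinearMap.lsmul R _ a), isCompatible_of_forall_exists_smul hR hK
    fun v hv => ⟨a, hv, fun w hw => hw⟩, ?_⟩
  ext x
  simp [mem_annihilator_quotient_iff, Submodule.mem_colon_singleton, mul_smul,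
    smul_comm x a]

theorem IsSpecial.isSpecialPrime_of_mem_minimalPrimes [IsNoetherianRing R]
    (hR : HasFrobeniusCoordinates p R) {J Q : Ideal R} (hJ : IsSpecial p U J)
    (hQ : Q ∈ J.minimalPrimes) : IsSpecialPrime p U Q := by
  -- In a Noetherian ring a minimal prime of a colon is itself a colon by an element; writing J as
  -- (J : 1) makes this applicable.
  have h1 : J.colon {1} = J := by
    ext x
    simp [Submodule.mem_colon_singleton]
  rw [← h1] at hQ
  obtain ⟨x, hx⟩ := Submodule.exists_eq_colon_of_mem_minimalPrimes hQ
  exact ⟨hQ.1.1, hx ▸ hJ.colon_singleton hR x⟩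

/-- The `Q`-saturation of a special ideal's module: a prime special ideal `Q` is the annihilator
of `R^r/W` for a compatible `W` on whose quotient the elements outside `Q` act injectively. -/
theorem IsSpecialPrime.exists_saturated (hR : HasFrobeniusCoordinates p R) {Q : Ideal R}
    (hQ : IsSpecialPrime p U Q) :
    ∃ W : Submodule R (Fin r → R), IsCompatible p U W ∧
      Q = Module.annihilator R ((Fin r → R) ⧸ W) ∧ ∀ s ∉ Q, ∀ w, s • w ∈ W → w ∈ W := by
  obtain ⟨hprime, K, hK, hann⟩ := hQ
  let W : Submodule R (Fin r → R) :=
    { carrier := {w | ∃ s ∉ Q, s • w ∈ K}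
      zero_mem' := ⟨1, hprime.one_notMem, by simp⟩
      add_mem' := by
        rintro v w ⟨s, hs, hv⟩ ⟨t, ht, hw⟩
        refine ⟨s * t, hprime.mul_notMem hs ht, ?_⟩
        rw [smul_add]
        refine K.add_mem ?_ ?_
        · rw [mul_comm, mul_smul]
          exact K.smul_mem _ hv
        · rw [mul_smul]
          exact K.smul_mem _ hw
      smul_mem' := by
        rintro a w ⟨s, hs, hw⟩
        exact ⟨s, hs, by rw [smul_comm]; exact K.smul_mem _ hw⟩ }
  have hsat : ∀ s ∉ Q, ∀ w, s • w ∈ W → w ∈ W := by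
    rintro s hs w ⟨t, ht, hw⟩
    exact ⟨t * s, hprime.mul_notMem ht hs, by rwa [mul_smul]⟩
  refine ⟨W, isCompatible_of_forall_exists_smul hR hK ?_, ?_, hsat⟩
  · rintro v ⟨s, hs, hv⟩
    exact ⟨s, hv, fun w hw => ⟨s, hs, hw⟩⟩
  · apply le_antisymm
    · intro x hx
      rw [mem_annihilator_quotient_iff]
      intro v
      rw [hann, mem_annihilator_quotient_iff] at hx
      exact ⟨1, hprime.one_notMem, by simpa using hx v⟩
    · intro x hx
      rw [mem_annihilator_quotient_iff] at hx
      -- One denominator per basis vector; their product works for all of R^r and stays outside the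
      -- prime Q.
      choose s hs hsx using fun i : Fin r => hx (Pi.single i 1)
      have hmem : (∏ i, s i) * x ∈ Q := by
        rw [hann, mem_annihilator_quotient_iff]
        intro v
        rw [pi_eq_sum_univ' v, Finset.smul_sum]
        refine Submodule.sum_mem _ fun i _ => ?_
        rw [← Finset.prod_erase_mul _ _ (Finset.mem_univ i), mul_assoc, mul_smul, smul_comm _ (v i)]
        refine K.smul_mem _ (K.smul_mem _ ?_)
        have := hsx i
        rw [← mul_smul] at this
        convert this using 2
      refine (hprime.mem_or_mem hmem).resolve_left fun h => ?_
      obtain ⟨i, -, hi⟩ := (Ideal.IsPrime.prod_mem_iff).1 h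
      exact hs i hi

theorem MinimallyContains.mem_minimalPrimes_annStar [IsNoetherianRing R]
    (hR : HasFrobeniusCoordinates p R) {P Q : Ideal R} (h : MinimallyContains p U P Q) {a : R}
    (haQ : a ∈ Q) (haP : a ∉ P) : Q ∈ (annStar p U P a).minimalPrimes := by
  obtain ⟨⟨hprime, K, hK, hann⟩, hPQ, hmin⟩ := h
  have hle : P ⊔ Ideal.span {a} ≤ annStar p U P a :=
    (smul_top_le_iff _ _).1 (le_starClosure _)
  have hQ : annStar p U P a ≤ Q := by
    have h1 : starClosure p U ((P ⊔ Ideal.span {a}) • (⊤ : Submodule R (Fin r → R))) ≤ K := by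
      refine starClosure_le ((smul_top_le_iff _ _).2 ?_) hK
      rw [← hann]
      exact sup_le hPQ.le ((Ideal.span_singleton_le_iff_mem _).2 haQ)
    intro x hx
    rw [hann, mem_annihilator_quotient_iff]
    exact fun v => h1 ((mem_annihilator_quotient_iff _ _).1 hx v)
  obtain ⟨Q', hQ', hQ'Q⟩ := Ideal.exists_minimalPrimes_le hQ
  have hsp : IsSpecialPrime p U Q' := IsSpecial.isSpecialPrime_of_mem_minimalPrimes hR
    ⟨_, isCompatible_starClosure hR _, rfl⟩ hQ'
  have hle' := hle.trans hQ'.1.2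
  have hPQ' : P < Q' := lt_of_le_of_ne (le_sup_left.trans hle') fun h =>
    haP (h ▸ hle' (Ideal.mem_sup_right (Ideal.mem_span_singleton_self a)))
  have : Q' = Q := by
    by_contra hne
    exact hmin Q' hsp ⟨hPQ', lt_of_le_of_ne hQ'Q hne⟩
  exact this ▸ hQ'

end Coordinates

/-! ### Generic generators of (P^[p] : P)/P^[p]. -/

/-- For each prime `P`, the module `(P^[p] : P) / P^[p]` is generically generated by one element. -/
def HasFrobeniusGenerators (p : ℕ) (A : Type*) [CommRing A] : Prop :=
  ∀ P : Ideal A, P.IsPrime → ∃ g : A, (∀ x ∈ P, g * x ∈ idealFrobPow p P) ∧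
    ∀ f, (∀ x ∈ P, f * x ∈ idealFrobPow p P) → ∃ a ∉ P, ∃ v, a * f - g * v ∈ idealFrobPow p P

theorem exists_common_multiplier {A κ : Type*} [CommRing A] {P I : Ideal A} (hP : P.IsPrime)
    (f : κ → A) (g : A) (s : Finset κ) (h : ∀ i ∈ s, ∃ a ∉ P, ∃ v, a * f i - g * v ∈ I) :
    ∃ a ∉ P, ∀ i ∈ s, ∃ v, a * f i - g * v ∈ I := by
  classical
  choose! a ha v hv using h
  refine ⟨∏ i ∈ s, a i, fun hmem => ?_, fun i hi => ⟨(∏ j ∈ s.erase i, a j) * v i, ?_⟩⟩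
  · obtain ⟨i, hi, hi'⟩ := hP.prod_mem_iff.1 hmem
    exact ha i hi hi'
  · rw [← Finset.prod_erase_mul _ _ hi]
    convert I.mul_mem_left (∏ j ∈ s.erase i, a j) (hv i hi) using 1
    ring

theorem HasFrobeniusGenerators.field (p : ℕ) [Fact p.Prime] (k : Type*) [Field k] :
    HasFrobeniusGenerators p k := by
  intro P hP
  obtain rfl : P = ⊥ := (Ideal.eq_bot_or_top P).resolve_right hP.ne_top
  refine ⟨1, fun x hx => ?_, fun f _ => ⟨1, hP.one_notMem, f, by simp⟩⟩
  simp [(Ideal.mem_bot).1 hx]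

theorem HasFrobeniusGenerators.of_ringEquiv {p : ℕ} {A B : Type*} [CommRing A] [CommRing B]
    (e : A ≃+* B) (h : HasFrobeniusGenerators p A) : HasFrobeniusGenerators p B := by
  intro P hP
  have h1 : ∀ x ∈ idealFrobPow p (P.comap (e : A →+* B)), e x ∈ idealFrobPow p P := fun x hx =>
    map_mem_idealFrobPow p (e : A →+* B) (fun y hy => hy) hx
  have h2 : ∀ x ∈ idealFrobPow p P, e.symm x ∈ idealFrobPow p (P.comap (e : A →+* B)) :=
    fun x hx => map_mem_idealFrobPow p (e.symm : B →+* A)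
      (fun y hy => by simpa only [Ideal.mem_comap, RingHom.coe_coe, e.apply_symm_apply] using hy) hx
  obtain ⟨g, hg, hf⟩ := h (P.comap (e : A →+* B)) (hP.comap _)
  refine ⟨e g, fun x hx => ?_, fun f hfP => ?_⟩
  · simpa using h1 _ (hg (e.symm x)
      (by simpa only [Ideal.mem_comap, RingHom.coe_coe, e.apply_symm_apply] using hx))
  · obtain ⟨a, ha, v, hv⟩ := hf (e.symm f) fun x hx => by
      simpa using h2 _ (hfP (e x) hx)
    exact ⟨e a, ha, e v, by simpa using h1 _ hv⟩

theorem idealFrobPow_map_le {A B : Type*} [CommRing A] [CommRing B] (p : ℕ) [Fact p.Prime]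
    [CharP B p] (φ : A →+* B) (I : Ideal A) :
    idealFrobPow p (I.map φ) ≤ (idealFrobPow p I).map φ := by
  refine Ideal.span_le.2 ?_
  rintro _ ⟨x, hx, rfl⟩
  change x ^ p ∈ (idealFrobPow p I).map φ
  induction hx using Submodule.span_induction with
  | mem x hx =>
    obtain ⟨y, hy, rfl⟩ := hx
    rw [← map_pow]
    exact Ideal.mem_map_of_mem _ (pow_mem_idealFrobPow p hy)
  | zero => simp [(Fact.out : p.Prime).ne_zero]
  | add x y _ _ hx hy => simpa only [add_pow_char] using Ideal.add_mem _ hx hy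
  | smul a x _ hx => simpa only [smul_eq_mul, mul_pow] using Ideal.mul_mem_left _ _ hx

/-! ### Passing generic generators from A to A[X]. -/

section Polynomial

open Polynomial

variable {A : Type*} [CommRing A]

theorem exists_pseudo_division [IsDomain A] {h : A[X]} (h0 : h ≠ 0) (f : A[X]) :
    ∃ (N : ℕ) (q r : A[X]), C h.leadingCoeff ^ N * f = h * q + r ∧ r.degree < h.degree := by
  induction hd : f.degree using WellFoundedLT.induction generalizing f with
  | ind d ih =>
    subst hd
    by_cases hlt : f.degree < h.degree
    · exact ⟨0, 0, f, by simp, hlt⟩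
    rw [not_lt] at hlt
    have hf0 : f ≠ 0 := by
      rintro rfl
      simp [h0] at hlt
    have hc : h.leadingCoeff ≠ 0 := leadingCoeff_ne_zero.2 h0
    have hlf : f.leadingCoeff ≠ 0 := leadingCoeff_ne_zero.2 hf0
    have hnat : h.natDegree ≤ f.natDegree := natDegree_le_natDegree hlt
    let f' := C h.leadingCoeff * f - h * monomial (f.natDegree - h.natDegree) f.leadingCoeff
    have hdeg : f'.degree < f.degree := by
      have hCf : (C h.leadingCoeff * f).degree = f.degree := by
        rw [degree_mul, degree_C hc, zero_add]
      rw [← hCf]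
      apply degree_sub_lt_left
      · rw [hCf, degree_mul, degree_monomial _ hlf, degree_eq_natDegree h0, degree_eq_natDegree hf0,
          ← Nat.cast_add, Nat.add_sub_cancel' hnat]
      · exact mul_ne_zero (C_ne_zero.2 hc) hf0
      · simp
    obtain ⟨N, q, r, hqr, hr⟩ := ih f'.degree hdeg f' rfl
    refine ⟨N + 1, q + C h.leadingCoeff ^ N *
      monomial (f.natDegree - h.natDegree) f.leadingCoeff, r, ?_, hr⟩
    simp only [f'] at hqr
    linear_combination hqr

theorem mem_map_C_of_mul_sub_mem {J : Ideal A} {h u r : A[X]}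
    (hc : ∀ x, h.leadingCoeff * x ∈ J → x ∈ J) (hr : r.degree < h.degree)
    (hu : h * u - r ∈ J.map C) : u ∈ J.map C := by
  have hmem : ∀ f : A[X], f ∈ J.map C ↔ f.map (Ideal.Quotient.mk J) = 0 := by
    intro f
    rw [Ideal.mem_map_C_iff, Polynomial.ext_iff]
    simp [Ideal.Quotient.eq_zero_iff_mem]
  rw [hmem] at hu ⊢
  by_contra hu0
  rw [Polynomial.map_sub, Polynomial.map_mul, sub_eq_zero] at hu
  have hlc : Ideal.Quotient.mk J h.leadingCoeff ≠ 0 := by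
    intro h0
    rw [Ideal.Quotient.eq_zero_iff_mem] at h0
    have h1 : (1 : A) ∈ J := hc 1 (by simpa using h0)
    refine hu0 ((hmem u).1 ?_)
    rw [(Ideal.eq_top_iff_one J).2 h1, Ideal.map_top]
    trivial
  have hdeg : (h.map (Ideal.Quotient.mk J)).degree = h.degree :=
    degree_map_eq_of_leadingCoeff_ne_zero _ hlc
  -- A/J need not be a domain; degrees still add because the leading coefficient of h is a
  -- nonzerodivisor modulo J.
  have hne : (h.map (Ideal.Quotient.mk J)).leadingCoeff *
      (u.map (Ideal.Quotient.mk J)).leadingCoeff ≠ 0 := by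
    rw [leadingCoeff_map_of_leadingCoeff_ne_zero _ hlc]
    obtain ⟨t, ht⟩ := Ideal.Quotient.mk_surjective (u.map (Ideal.Quotient.mk J)).leadingCoeff
    rw [← ht, ← map_mul]
    intro h0
    rw [Ideal.Quotient.eq_zero_iff_mem] at h0
    apply hu0
    rw [← leadingCoeff_eq_zero, ← ht, Ideal.Quotient.eq_zero_iff_mem]
    exact hc t h0
  have h1 := degree_mul' hne
  rw [hu, hdeg] at h1
  have h2 : (r.map (Ideal.Quotient.mk J)).degree ≤ r.degree := degree_map_le
  have h3 : h.degree ≤ h.degree + (u.map (Ideal.Quotient.mk J)).degree :=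
    le_add_of_nonneg_right (zero_le_degree_iff.2 hu0)
  exact absurd (h3.trans (h1 ▸ h2)) (not_le.2 hr)

theorem mem_map_C_of_pow_mul_mem {J : Ideal A} {h : A[X]} (h0 : h ≠ 0)
    (hc : ∀ x, h.leadingCoeff * x ∈ J → x ∈ J) (n : ℕ) {u : A[X]} (hu : h ^ n * u ∈ J.map C) :
    u ∈ J.map C := by
  induction n with
  | zero => simpa using hu
  | succ n ih =>
    refine ih (mem_map_C_of_mul_sub_mem (r := 0) hc ?_ ?_)
    · rw [degree_zero]
      exact bot_lt_iff_ne_bot.2 (mt degree_eq_bot.1 h0)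
    · rw [sub_zero, ← mul_assoc, ← pow_succ']
      exact hu

/-- Take h of least degree in P outside the extended ideal. Were its leading coefficient in P ∩ A,
removing the leading term would leave a smaller element of P, hence one in the extended ideal, and h
would be there too. -/
theorem exists_minimal_degree_mem {P : Ideal A[X]} (hP : ¬ P ≤ (P.comap C).map C) :
    ∃ h ∈ P, h.leadingCoeff ∉ P.comap C ∧
      ∀ r ∈ P, r.degree < h.degree → r ∈ (P.comap C).map C := by
  obtain ⟨f, hfP, hf⟩ := SetLike.not_le_iff_exists.1 hP
  obtain ⟨h, ⟨hhP, hh⟩, hmin⟩ := (InvImage.wf (degree : A[X] → WithBot ℕ) wellFounded_lt).has_min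
    {f | f ∈ P ∧ f ∉ (P.comap C).map C} ⟨f, hfP, hf⟩
  have hsmall : ∀ r ∈ P, r.degree < h.degree → r ∈ (P.comap C).map C := fun r hrP hr => by
    by_contra hr'
    exact hmin r ⟨hrP, hr'⟩ hr
  refine ⟨h, hhP, fun hlc => hh ?_, hsmall⟩
  have h0 : h ≠ 0 := by
    rintro rfl
    exact hh (Ideal.zero_mem _)
  have hsum := eraseLead_add_monomial_natDegree_leadingCoeff h
  have hmon : monomial h.natDegree h.leadingCoeff ∈ (P.comap C).map C := by
    rw [← C_mul_X_pow_eq_monomial]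
    exact Ideal.mul_mem_right _ _ (Ideal.mem_map_of_mem _ hlc)
  rw [← hsum]
  refine Ideal.add_mem _ (hsmall _ ?_ (degree_eraseLead_lt h0)) hmon
  rw [eq_sub_of_add_eq hsum]
  exact P.sub_mem hhP (Ideal.map_comap_le hmon)

theorem exists_multiplier_of_coeff {p0 D : Ideal A} (hp0 : p0.IsPrime) {g : A}
    (hg : ∀ f, (∀ x ∈ p0, f * x ∈ D) → ∃ a ∉ p0, ∃ v, a * f - g * v ∈ D) {f : A[X]}
    (hf : ∀ n, ∀ x ∈ p0, f.coeff n * x ∈ D) :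
    ∃ a ∉ p0, ∃ v, C a * f - C g * v ∈ D.map C := by
  obtain ⟨a, ha, hv⟩ := exists_common_multiplier hp0 f.coeff g f.support
    fun n _ => hg (f.coeff n) (hf n)
  choose! v hv using hv
  refine ⟨a, ha, ∑ n ∈ f.support, monomial n (v n), ?_⟩
  rw [Ideal.mem_map_C_iff]
  intro n
  rw [coeff_sub, coeff_C_mul, coeff_C_mul, finsetSum_coeff]
  simp only [coeff_monomial, Finset.sum_ite_eq']
  split_ifs with hn
  · exact hv n hn
  · simp [notMem_support_iff.1 hn]

theorem exists_pow_mul_eq_of_mem_idealFrobPow {p : ℕ} [Fact p.Prime] [CharP A p] {P : Ideal A[X]}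
    {I : Ideal A} {c : A} {h : A[X]}
    (hx : ∀ x ∈ P, ∃ (N : ℕ) (q v : A[X]), C c ^ N * x = h * q + v ∧ v ∈ I.map C)
    {y : A[X]} (hy : y ∈ idealFrobPow p P) :
    ∃ (N : ℕ) (q v : A[X]), C c ^ N * y = h ^ p * q + v ∧ v ∈ (idealFrobPow p I).map C := by
  induction hy using Submodule.span_induction with
  | mem y hy =>
    obtain ⟨x, hxP, rfl⟩ := hy
    obtain ⟨N, q, v, hqv, hv⟩ := hx x hxP
    refine ⟨N * p, q ^ p, v ^ p, ?_, idealFrobPow_map_le p C I (pow_mem_idealFrobPow p hv)⟩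
    rw [pow_mul, ← mul_pow, ← mul_pow, ← add_pow_char, ← hqv]
  | zero => exact ⟨0, 0, 0, by simp, Ideal.zero_mem _⟩
  | add y z _ _ hy hz =>
    obtain ⟨N, q, v, hqv, hv⟩ := hy
    obtain ⟨N', q', v', hqv', hv'⟩ := hz
    refine ⟨N + N', C c ^ N' * q + C c ^ N * q', C c ^ N' * v + C c ^ N * v', ?_,
      Ideal.add_mem _ (Ideal.mul_mem_left _ _ hv) (Ideal.mul_mem_left _ _ hv')⟩
    linear_combination C c ^ N' * hqv + C c ^ N * hqv'
  | smul a y _ hy =>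
    obtain ⟨N, q, v, hqv, hv⟩ := hy
    refine ⟨N, a * q, a * v, ?_, Ideal.mul_mem_left _ _ hv⟩
    rw [smul_eq_mul]
    linear_combination a * hqv

universe u

/-- Let p₀ = P ∩ A with generator g. If P is extended from p₀, g still works. Otherwise, after
inverting the leading coefficient c of a minimal h, P becomes (h) + p₀A[X] and P^[p] becomes (h^p) +
p₀^[p]A[X]; the generator is g·h^(p-1). -/
theorem HasFrobeniusGenerators.polynomial {p : ℕ} [Fact p.Prime] {A : Type u} [CommRing A]
    [IsDomain A] [CharP A p] (hA : HasFrobeniusCoordinates p A)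
    (hgen : HasFrobeniusGenerators p A) : HasFrobeniusGenerators p A[X] := by
  intro P hP
  have hp0 : (P.comap C).IsPrime := hP.comap C
  obtain ⟨g, hg, hgf⟩ := hgen (P.comap C) hp0
  have hAX : HasFrobeniusCoordinates p A[X] := hA.polynomial
  have hDP : (idealFrobPow p (P.comap C)).map C ≤ idealFrobPow p P :=
    Ideal.map_le_iff_le_comap.2 fun x hx => map_mem_idealFrobPow p C (fun y hy => hy) hx
  have hgmap : ∀ v ∈ (P.comap C).map C, C g * v ∈ (idealFrobPow p (P.comap C)).map C := by
    intro v hv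
    rw [Ideal.mem_map_C_iff] at hv ⊢
    intro n
    rw [coeff_C_mul]
    exact hg _ (hv n)
  by_cases hle : P ≤ (P.comap C).map C
  · refine ⟨C g, fun x hx => hDP (hgmap x (hle hx)), fun f hf => ?_⟩
    have hPD : idealFrobPow p P ≤ (idealFrobPow p (P.comap C)).map C :=
      (idealFrobPow_mono p hle).trans (idealFrobPow_map_le p C _)
    obtain ⟨a, ha, v, hv⟩ := exists_multiplier_of_coeff hp0 hgf (f := f) fun n y hy => by
      have := Ideal.mem_map_C_iff.1 (hPD (hf (C y) hy)) n
      rwa [coeff_mul_C] at this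
    exact ⟨C a, ha, v, hDP hv⟩
  obtain ⟨h, hhP, hc, hsmall⟩ := exists_minimal_degree_mem hle
  have h0 : h ≠ 0 := by
    rintro rfl
    simp at hc
  set c := h.leadingCoeff with hcdef
  set D := idealFrobPow p (P.comap C) with hD
  have hcD : ∀ x, c * x ∈ D → x ∈ D := fun x => mem_idealFrobPow_of_mul_mem hA hp0 hc
  have hcP : ∀ N : ℕ, C c ^ N ∉ P := fun N hN => hc (hP.mem_of_pow_mem N hN)
  obtain ⟨l, hl⟩ := Nat.exists_eq_succ_of_ne_zero (Fact.out : p.Prime).ne_zero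
  have hpow : h ^ p = h ^ l * h := by rw [hl, pow_succ]
  have hhp : h ^ p ∈ idealFrobPow p P := pow_mem_idealFrobPow p hhP
  have hdiv : ∀ x ∈ P, ∃ (N : ℕ) (q v : A[X]),
      C c ^ N * x = h * q + v ∧ v ∈ (P.comap C).map C := by
    intro x hx
    obtain ⟨N, q, r, hqr, hr⟩ := exists_pseudo_division h0 x
    refine ⟨N, q, r, hqr, hsmall r ?_ hr⟩
    rw [← sub_eq_of_eq_add' hqr]
    exact P.sub_mem (P.mul_mem_left _ hx) (P.mul_mem_right _ hhP)
  refine ⟨C g * h ^ l, fun x hx => ?_, fun f hf => ?_⟩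
  · obtain ⟨N, q, v, hqv, hv⟩ := hdiv x hx
    refine mem_idealFrobPow_of_mul_mem hAX hP (hcP N) ?_
    have : C c ^ N * (C g * h ^ l * x) = C g * q * h ^ p + h ^ l * (C g * v) := by
      rw [hpow]
      linear_combination C g * h ^ l * hqv
    rw [this]
    exact Ideal.add_mem _ (Ideal.mul_mem_left _ _ hhp) (Ideal.mul_mem_left _ _ (hDP (hgmap v hv)))
  -- Cancelling one h from fh ∈ P^[p] gives c^N f ≡ h^(p-1) w; then w is replaced by its remainder r
  -- on division by h.
  · obtain ⟨N, w, v, hwv, hv⟩ := exists_pow_mul_eq_of_mem_idealFrobPow hdiv (hf h hhP)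
    have ht : C c ^ N * f - h ^ l * w ∈ D.map C := by
      refine mem_map_C_of_pow_mul_mem h0 hcD 1 ?_
      convert hv using 1
      rw [hpow] at hwv
      linear_combination hwv
    obtain ⟨M, q, r, hqr, hr⟩ := exists_pseudo_division h0 w
    -- The coefficients of r lie in (D : p₀): for y ∈ p₀, the relation fy ∈ P^[p] makes a multiple
    -- of h congruent to −c^N' y r modulo D, and comparing degrees forces c^N' y r to vanish modulo
    -- D.
    obtain ⟨a, ha, u, hu⟩ := exists_multiplier_of_coeff hp0 hgf (f := r) fun n y hy => by
      obtain ⟨N', q', v', hqv', hv'⟩ := exists_pow_mul_eq_of_mem_idealFrobPow hdiv (hf (C y) hy)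
      have h1 : C c ^ N' * C y * w - h * (C c ^ N * q') ∈ D.map C := by
        refine mem_map_C_of_pow_mul_mem h0 hcD l ?_
        have : h ^ l * (C c ^ N' * C y * w - h * (C c ^ N * q')) =
            C c ^ N * v' - C c ^ N' * C y * (C c ^ N * f - h ^ l * w) := by
          rw [hpow] at hqv'
          linear_combination (C c ^ N) * hqv'
        rw [this]
        exact Ideal.sub_mem _ (Ideal.mul_mem_left _ _ hv') (Ideal.mul_mem_left _ _ ht)
      have h2 : h * (C c ^ N' * C y * q - C c ^ M * (C c ^ N * q')) -
          -(C (c ^ N' * y) * r) ∈ D.map C := by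
        convert Ideal.mul_mem_left _ (C c ^ M) h1 using 1
        rw [C_mul, C_pow]
        linear_combination (-(C c ^ N' * C y)) * hqr
      have h3 := mem_map_C_of_mul_sub_mem hcD
        (by rw [degree_neg]
            exact ((degree_mul_le _ _).trans (add_le_of_nonpos_left degree_C_le)).trans_lt hr) h2
      have h4 : C (c ^ N' * y) * r ∈ D.map C := by
        convert Ideal.sub_mem _ h2 (Ideal.mul_mem_left _ h h3) using 1
        ring
      have h5 := Ideal.mem_map_C_iff.1 h4 n
      rw [coeff_C_mul] at h5
      refine mem_idealFrobPow_of_mul_mem hA hp0 (fun hcN => hc (hp0.mem_of_pow_mem N' hcN)) ?_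
      convert h5 using 1
      ring
    refine ⟨C a * C c ^ (M + N), hP.mul_notMem ha (hcP _), u, ?_⟩
    have : C a * C c ^ (M + N) * f - C g * h ^ l * u = C a * q * h ^ p +
        h ^ l * (C a * r - C g * u) + C a * C c ^ M * (C c ^ N * f - h ^ l * w) := by
      rw [hpow]
      linear_combination (C a * h ^ l) * hqr
    rw [this]
    exact Ideal.add_mem _ (Ideal.add_mem _ (Ideal.mul_mem_left _ _ hhp)
      (Ideal.mul_mem_left _ _ (hDP hu))) (Ideal.mul_mem_left _ _ (hDP ht))

end Polynomial

section MvPolynomial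

universe u

theorem mvPolynomial_frobenius (p : ℕ) [Fact p.Prime] (k : Type u) [Field k] [CharP k p] (n : ℕ) :
    HasFrobeniusCoordinates p (MvPolynomial (Fin n) k) ∧
      HasFrobeniusGenerators p (MvPolynomial (Fin n) k) := by
  induction n with
  | zero =>
    let e := (MvPolynomial.isEmptyRingEquiv k (Fin 0)).symm
    exact ⟨(hasFrobeniusCoordinates_field p k).of_ringEquiv e,
      (HasFrobeniusGenerators.field p k).of_ringEquiv e⟩
  | succ n ih =>
    let e := (MvPolynomial.finSuccEquiv k n).toRingEquiv.symm
    exact ⟨ih.1.polynomial.of_ringEquiv e, (ih.2.polynomial ih.1).of_ringEquiv e⟩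

end MvPolynomial

/-- Some power of P lies in P^[p]. If (P^[p] : P) were P^[p], factors of P could be stripped off one
by one until 1 ∈ P^[p] ⊆ P. -/
theorem exists_mem_colon_notMem_idealFrobPow {A : Type*} [CommRing A] [IsNoetherianRing A] {p : ℕ}
    [Fact p.Prime] {P : Ideal A} (hP : P.IsPrime) :
    ∃ f, (∀ x ∈ P, f * x ∈ idealFrobPow p P) ∧ f ∉ idealFrobPow p P := by
  by_contra! hcon
  have hrad : P ≤ (idealFrobPow p P).radical := fun x hx => ⟨p, pow_mem_idealFrobPow p hx⟩
  obtain ⟨n, hn⟩ := Ideal.exists_pow_le_of_le_radical_of_fg hrad (IsNoetherian.noetherian P)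
  have key : ∀ n, P ^ n ≤ idealFrobPow p P → (1 : A) ∈ idealFrobPow p P := by
    intro n
    induction n with
    | zero => exact fun h => h (by simp)
    | succ n ih =>
      refine fun h => ih fun y hy => hcon y fun x hx => h ?_
      rw [pow_succ]
      exact Ideal.mul_mem_mul hy hx
  exact hP.one_notMem (idealFrobPow_le_self (Fact.out : p.Prime).ne_zero P (key n hn))

theorem generator_notMem_idealFrobPow {A : Type*} [CommRing A] [IsNoetherianRing A] {p : ℕ}
    [Fact p.Prime] {P : Ideal A} (hP : P.IsPrime)
    (hsat : ∀ a x, a ∉ P → a * x ∈ idealFrobPow p P → x ∈ idealFrobPow p P) {g : A}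
    (hg : ∀ f, (∀ x ∈ P, f * x ∈ idealFrobPow p P) →
      ∃ a ∉ P, ∃ v, a * f - g * v ∈ idealFrobPow p P) : g ∉ idealFrobPow p P := by
  obtain ⟨f, hfP, hf⟩ := exists_mem_colon_notMem_idealFrobPow (p := p) hP
  obtain ⟨a, ha, v, hv⟩ := hg f hfP
  intro hgP
  refine hf (hsat a f ha ?_)
  have := Ideal.add_mem _ hv (Ideal.mul_mem_right v _ hgP)
  rwa [sub_add_cancel] at this

/-! ### Clearing denominators over R_a. -/

section Away

variable {R : Type*} [CommRing R] {r s m p : ℕ} {a : R}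

theorem exists_map_eq_pow_smul (a : R) (X : Matrix (Fin r) (Fin s) (Localization.Away a)) :
    ∃ (N : ℕ) (Y : Matrix (Fin r) (Fin s) R),
      Y.map (algebraMap R (Localization.Away a)) =
        algebraMap R (Localization.Away a) a ^ N • X := by
  obtain ⟨⟨_, N, rfl⟩, hb⟩ := IsLocalization.exist_integer_multiples_of_finite
    (Submonoid.powers a) fun ij : Fin r × Fin s => X ij.1 ij.2
  choose Y hY using hb
  refine ⟨N, Matrix.of fun i j => Y (i, j), ?_⟩
  ext i j
  simpa [Algebra.smul_def] using hY (i, j)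

theorem exists_isTransform (p : ℕ) (U : Matrix (Fin r) (Fin r) R) (a : R)
    (X : GL (Fin r) (Localization.Away a)) : ∃ U₁, IsTransform p U a X U₁ := by
  obtain ⟨N, Y, hY⟩ := exists_map_eq_pow_smul a
    ((X : Matrix (Fin r) (Fin r) (Localization.Away a)).map (fun x => x ^ p) *
        U.map (algebraMap R (Localization.Away a)) *
        ((X⁻¹ : GL (Fin r) (Localization.Away a)) :
          Matrix (Fin r) (Fin r) (Localization.Away a)))
  exact ⟨Y, N, hY⟩

theorem exists_pow_smul_mem_of_mem_extendAway {N : Submodule R (Fin r → R)}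
    {v : Fin r → Localization.Away a} (hv : v ∈ extendAway a N) :
    ∃ (l : ℕ), ∃ w ∈ N, algebraMap R (Localization.Away a) a ^ l • v =
      fun i => algebraMap R (Localization.Away a) (w i) := by
  induction hv using Submodule.span_induction with
  | mem v hv =>
    obtain ⟨w, hw, rfl⟩ := hv
    exact ⟨0, w, hw, by simp⟩
  | zero => exact ⟨0, 0, N.zero_mem, by ext; simp⟩
  | add x y _ _ hx hy =>
    obtain ⟨l, w, hw, hlw⟩ := hx
    obtain ⟨l', w', hw', hlw'⟩ := hy
    refine ⟨l + l', a ^ l' • w + a ^ l • w', N.add_mem (N.smul_mem _ hw) (N.smul_mem _ hw'), ?_⟩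
    ext i
    have h1 := congrFun hlw i
    have h2 := congrFun hlw' i
    simp only [Pi.smul_apply, smul_eq_mul] at h1 h2
    simp only [Pi.smul_apply, Pi.add_apply, smul_eq_mul, map_add, map_mul, map_pow]
    rw [← h1, ← h2]
    ring
  | smul c x _ hx =>
    obtain ⟨l, w, hw, hlw⟩ := hx
    obtain ⟨n, d, hd⟩ := IsLocalization.Away.surj a c
    refine ⟨l + n, d • w, N.smul_mem _ hw, ?_⟩
    ext i
    have h1 := congrFun hlw i
    simp only [Pi.smul_apply, smul_eq_mul, map_mul] at h1 ⊢
    rw [← h1, ← hd]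
    ring

theorem KillsLastColumn.mulVec_mem {X : GL (Fin (m + 1)) (Localization.Away a)}
    {V : Matrix (Fin (m + 1)) (Fin (m + 1)) R} {P : Ideal R} (hP : P.IsPrime) (ha : a ∉ P)
    (h : KillsLastColumn a X V P) {Z : Matrix (Fin (m + 1)) (Fin (m + 1)) R} {N : ℕ}
    (hZ : Z.map (algebraMap R (Localization.Away a)) = algebraMap R (Localization.Away a) a ^ N •
        ((X⁻¹ : GL (Fin (m + 1)) (Localization.Away a)) :
          Matrix (Fin (m + 1)) (Fin (m + 1)) (Localization.Away a))) (i : Fin (m + 1)) :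
    (V *ᵥ (Z *ᵥ Pi.single (Fin.last m) 1)) i ∈ P := by
  have h1 : algebraMap R (Localization.Away a) ((V * Z) i (Fin.last m)) ∈
      P.map (algebraMap R (Localization.Away a)) := by
    have h2 : (V * Z).map (algebraMap R (Localization.Away a)) =
        algebraMap R (Localization.Away a) a ^ N •
          (V.map (algebraMap R (Localization.Away a)) *
            ((X⁻¹ : GL (Fin (m + 1)) (Localization.Away a)) :
              Matrix (Fin (m + 1)) (Fin (m + 1)) (Localization.Away a))) := by
      rw [Matrix.map_mul, hZ, Matrix.mul_smul]
    have h3 := congrFun (congrFun h2 i) (Fin.last m)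
    rw [Matrix.map_apply] at h3
    rw [h3]
    exact Ideal.mul_mem_left _ _ (h i)
  rw [Matrix.mulVec_mulVec, Matrix.mulVec_single_one, Matrix.col_apply]
  have hdisj : Disjoint (Submonoid.powers a : Set R) (P : Set R) := by
    rw [Set.disjoint_left]
    rintro _ ⟨n, rfl⟩ hn
    exact ha (hP.mem_of_pow_mem n hn)
  rw [← IsLocalization.under_map_of_isPrime_disjoint (Submonoid.powers a)
    (Localization.Away a) hP hdisj]
  exact h1

theorem exists_last_column {v : Fin (m + 1) → R} {i : Fin (m + 1)} (hv : v i = a) :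
    ∃ X : GL (Fin (m + 1)) (Localization.Away a),
      ((X⁻¹ : GL (Fin (m + 1)) (Localization.Away a)) :
          Matrix (Fin (m + 1)) (Fin (m + 1)) (Localization.Away a)) *ᵥ Pi.single (Fin.last m) 1 =
        fun i => algebraMap R (Localization.Away a) (v i) := by
  -- Swapping rows i and last puts the entry a in the corner of the identity with replaced last
  -- column; swapping back gives last column v and determinant ±a.
  let u : Fin (m + 1) → Localization.Away a :=
    fun j => algebraMap R (Localization.Away a) (v (Equiv.swap i (Fin.last m) j))
  let B : Matrix (Fin (m + 1)) (Fin (m + 1)) (Localization.Away a) :=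
    (Matrix.updateCol 1 (Fin.last m) u).submatrix (Equiv.swap i (Fin.last m)) id
  have hB : IsUnit B.det := by
    change IsUnit ((Matrix.updateCol 1 (Fin.last m) u).submatrix (Equiv.swap i (Fin.last m)) id).det
    rw [Matrix.det_permute, ← Matrix.cramer_apply, Matrix.cramer_one]
    refine IsUnit.mul ?_ ?_
    · exact (Units.isUnit _).map (Int.castRingHom (Localization.Away a))
    · simpa [u, hv] using IsLocalization.Away.algebraMap_isUnit a
  obtain ⟨X, hX⟩ := (Matrix.isUnit_iff_isUnit_det B).2 hB
  refine ⟨X⁻¹, ?_⟩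
  rw [inv_inv, hX]
  ext j
  simp [B, u]

theorem exists_movesLastInto {v : Fin (m + 1) → R} {i : Fin (m + 1)} (hv : v i = a)
    {N : Submodule R (Fin (m + 1) → R)} (hN : v ∈ N) :
    ∃ X : GL (Fin (m + 1)) (Localization.Away a), MovesLastInto a X N := by
  obtain ⟨X, hX⟩ := exists_last_column hv
  refine ⟨X, fun i => algebraMap R (Localization.Away a) (v i),
    Submodule.subset_span ⟨v, hN, rfl⟩, ?_⟩
  rw [← hX, Matrix.mulVec_mulVec, ← Units.val_mul, mul_inv_cancel, Units.val_one,
    Matrix.one_mulVec]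

theorem exists_killsLastColumn {v : Fin (m + 1) → R} {i : Fin (m + 1)} (hv : v i = a)
    {V : Matrix (Fin (m + 1)) (Fin (m + 1)) R} {P : Ideal R} (hV : ∀ j, (V *ᵥ v) j ∈ P) :
    ∃ X : GL (Fin (m + 1)) (Localization.Away a), KillsLastColumn a X V P := by
  obtain ⟨X, hX⟩ := exists_last_column hv
  refine ⟨X, fun j => ?_⟩
  have h1 := congrFun (Matrix.mulVec_single_one (V.map (algebraMap R (Localization.Away a)) *
    ((X⁻¹ : GL (Fin (m + 1)) (Localization.Away a)) :
      Matrix (Fin (m + 1)) (Fin (m + 1)) (Localization.Away a))) (Fin.last m)) j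
  rw [Matrix.col_apply, ← Matrix.mulVec_mulVec, hX] at h1
  rw [← h1]
  convert Ideal.mem_map_of_mem (algebraMap R (Localization.Away a)) (hV j) using 1
  simp [Matrix.mulVec, dotProduct]

theorem exists_mulVec_mem_of_det_mem {V : Matrix (Fin r) (Fin r) R} {P : Ideal R}
    (hP : P.IsPrime) (hV : V.det ∈ P) :
    ∃ v : Fin r → R, (∃ i, v i ∉ P) ∧ ∀ i, (V *ᵥ v) i ∈ P := by
  have hdet : (V.map (Ideal.Quotient.mk P)).det = 0 := by
    rw [← RingHom.mapMatrix_apply, ← RingHom.map_det]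
    exact Ideal.Quotient.eq_zero_iff_mem.2 hV
  obtain ⟨w, hw, hVw⟩ := Matrix.exists_mulVec_eq_zero_iff.2 hdet
  choose v hv using fun i => Ideal.Quotient.mk_surjective (w i)
  refine ⟨v, ?_, fun i => ?_⟩
  · by_contra! hcon
    exact hw (funext fun i => by rw [← hv i]; exact Ideal.Quotient.eq_zero_iff_mem.2 (hcon i))
  · rw [← Ideal.Quotient.eq_zero_iff_mem]
    have := congrFun hVw i
    simpa [Matrix.mulVec, dotProduct, hv] using this

variable [IsDomain R]

theorem algebraMap_away_injective (ha : a ≠ 0) :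
    Function.Injective (algebraMap R (Localization.Away a)) :=
  IsLocalization.injective _ (powers_le_nonZeroDivisors_of_noZeroDivisors ha)

theorem exists_inverse_denominators (ha : a ≠ 0) (X : GL (Fin r) (Localization.Away a)) :
    ∃ (N K : ℕ) (Z Y : Matrix (Fin r) (Fin r) R),
      Z.map (algebraMap R (Localization.Away a)) = algebraMap R (Localization.Away a) a ^ N •
        ((X⁻¹ : GL (Fin r) (Localization.Away a)) :
          Matrix (Fin r) (Fin r) (Localization.Away a)) ∧
      Z * Y = a ^ K • 1 := by
  obtain ⟨N, Z, hZ⟩ := exists_map_eq_pow_smul a ((X⁻¹ : GL (Fin r) (Localization.Away a)) :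
          Matrix (Fin r) (Fin r) (Localization.Away a))
  obtain ⟨N', Y, hY⟩ := exists_map_eq_pow_smul a
    (X : Matrix (Fin r) (Fin r) (Localization.Away a))
  refine ⟨N, N + N', Z, Y, hZ, ?_⟩
  apply Matrix.map_injective (algebraMap_away_injective ha)
  beta_reduce
  rw [Matrix.map_mul, hZ, hY, smul_mul_smul_comm, ← Units.val_mul, inv_mul_cancel]
  ext i j
  rcases eq_or_ne i j with rfl | hij
  · simp [pow_add]
  · simp [hij]

theorem IsTransform.pow_smul_mul_eq {U U₁ Z : Matrix (Fin r) (Fin r) R} [Fact p.Prime] [CharP R p]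
    (ha : a ≠ 0) {X : GL (Fin r) (Localization.Away a)} (h : IsTransform p U a X U₁) {N : ℕ}
    (hZ : Z.map (algebraMap R (Localization.Away a)) = algebraMap R (Localization.Away a) a ^ N •
        ((X⁻¹ : GL (Fin r) (Localization.Away a)) :
          Matrix (Fin r) (Fin r) (Localization.Away a))) :
    ∃ L, a ^ N • (Z.map (fun x => x ^ p) * U₁) = a ^ L • (U * Z) := by
  obtain ⟨ν, hν⟩ := h
  have hinj := algebraMap_away_injective ha
  have : CharP (Localization.Away a) p := charP_of_injective_algebraMap hinj p
  -- With Z = a^N X⁻¹, the factor Z^[p] contributes a^(Np) and the transform a^ν; the a^N on the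
  -- left turns X⁻¹ back into Z.
  refine ⟨N * p + ν, ?_⟩
  apply Matrix.map_injective hinj
  set φ := algebraMap R (Localization.Away a)
  beta_reduce
  set X' : Matrix (Fin r) (Fin r) (Localization.Away a) :=
    (X : Matrix (Fin r) (Fin r) (Localization.Away a))
  set Xi : Matrix (Fin r) (Fin r) (Localization.Away a) :=
    ((X⁻¹ : GL (Fin r) (Localization.Away a)) : Matrix (Fin r) (Fin r) (Localization.Away a))
  have hXi : Xi * X' = 1 := by
    rw [← Units.val_mul, inv_mul_cancel, Units.val_one]
  have hfrob : Xi.map (fun x => x ^ p) * X'.map (fun x => x ^ p) = 1 := by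
    have := congrArg (fun M => M.map (frobenius (Localization.Away a) p)) hXi
    rw [Matrix.map_mul, Matrix.map_one _ (map_zero _) (map_one _)] at this
    exact this
  have hsm : ∀ (t : R) (M : Matrix (Fin r) (Fin r) R), (t • M).map φ = φ t • M.map φ := by
    intro t M
    ext i j
    simp
  have hZp : (Z.map (fun x => x ^ p)).map φ = φ a ^ (N * p) • Xi.map (fun x => x ^ p) := by
    ext i j
    have := congrArg (fun M => M i j ^ p) hZ
    simpa [mul_pow, ← pow_mul] using this
  rw [hsm, hsm, Matrix.map_mul, Matrix.map_mul, hZp, hν, hZ, map_pow, map_pow]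
  rw [smul_mul_smul_comm, Matrix.mul_assoc (X'.map _), ← Matrix.mul_assoc (Xi.map _), hfrob,
    Matrix.one_mul, Matrix.mul_smul, smul_smul, smul_smul, ← pow_add, ← pow_add, ← pow_add,
    add_comm N]

theorem MovesLastInto.exists_pow_smul_mem {X : GL (Fin (m + 1)) (Localization.Away a)}
    {W : Submodule R (Fin (m + 1) → R)} (ha : a ≠ 0) (h : MovesLastInto a X W)
    {Z : Matrix (Fin (m + 1)) (Fin (m + 1)) R} {N : ℕ}
    (hZ : Z.map (algebraMap R (Localization.Away a)) = algebraMap R (Localization.Away a) a ^ N •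
        ((X⁻¹ : GL (Fin (m + 1)) (Localization.Away a)) :
          Matrix (Fin (m + 1)) (Fin (m + 1)) (Localization.Away a))) :
    ∃ l, a ^ l • Z *ᵥ Pi.single (Fin.last m) 1 ∈ W := by
  obtain ⟨v, hv, hXv⟩ := h
  obtain ⟨l, w, hw, hlw⟩ := exists_pow_smul_mem_of_mem_extendAway hv
  have hv' : v = ((X⁻¹ : GL (Fin (m + 1)) (Localization.Away a)) :
          Matrix (Fin (m + 1)) (Fin (m + 1)) (Localization.Away a)) *ᵥ
          Pi.single (Fin.last m) 1 := by
    rw [← hXv, Matrix.mulVec_mulVec, ← Units.val_mul, inv_mul_cancel, Units.val_one,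
      Matrix.one_mulVec]
  refine ⟨l, ?_⟩
  have : a ^ l • Z *ᵥ Pi.single (Fin.last m) 1 = a ^ N • w := by
    ext i
    apply algebraMap_away_injective ha
    have h1 := congrFun hlw i
    have h2 := congrFun (congrFun hZ i) (Fin.last m)
    have h3 := congrFun hv' i
    simp only [Matrix.mulVec_single_one, Pi.smul_apply, Matrix.col_apply, smul_eq_mul, map_mul,
      map_pow, Matrix.map_apply, Matrix.smul_apply] at h1 h2 h3 ⊢
    rw [h2, ← h3, ← h1]
    ring
  rw [this]
  exact W.smul_mem _ hw

end Away

/-! ### Bounding the stable image. -/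

section StableImage

variable {R : Type*} [CommRing R] {r p : ℕ} [Fact p.Prime] [CharP R p]

theorem pow_mem_frobPow {W : Submodule R (Fin r → R)} {v : Fin r → R} (hv : v ∈ frobPow p W)
    (e : ℕ) : (fun i => v i ^ p ^ e) ∈ frobPow (p ^ (e + 1)) W := by
  induction hv using Submodule.span_induction with
  | mem v hv =>
    obtain ⟨w, hw, rfl⟩ := hv
    refine Submodule.subset_span ⟨w, hw, ?_⟩
    ext i
    simp [← pow_mul, pow_succ']
  | zero =>
    convert Submodule.zero_mem _ using 1
    ext i
    simp [(Fact.out : p.Prime).ne_zero]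
  | add x y _ _ hx hy =>
    convert Submodule.add_mem _ hx hy using 1
    ext i
    simp [add_pow_char_pow]
  | smul a x _ hx =>
    convert Submodule.smul_mem _ (a ^ p ^ e) hx using 1
    ext i
    simp [mul_pow]

theorem stableImage_le {U : Matrix (Fin r) (Fin r) R} {W : Submodule R (Fin r → R)}
    (h : ∀ v, U *ᵥ v ∈ frobPow p W) : stableImage p U ≤ W := by
  refine Filter.liminf_le_of_frequently_le' (Filter.Eventually.frequently ?_)
  -- The term e = 0 is all of R^r. For e ≥ 1 the leftmost factor has as columns the p^(e-1)-th
  -- powers of the columns of U, which lie in W^[p^e].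
  filter_upwards [Filter.eventually_ge_atTop 1] with e he
  obtain ⟨e, rfl⟩ := Nat.exists_eq_add_of_le' he
  refine sInf_le ?_
  rintro _ ⟨v, rfl⟩
  rw [Matrix.mulVecLin_apply, frobIter, ← Matrix.mulVec_mulVec]
  set w := frobIter p U e *ᵥ v
  rw [pi_eq_sum_univ' w, Matrix.mulVec_sum]
  refine Submodule.sum_mem _ fun j _ => ?_
  rw [Matrix.mulVec_smul]
  refine Submodule.smul_mem _ _ ?_
  convert pow_mem_frobPow (h (Pi.single j 1)) e using 1
  ext i
  simp

end StableImage

/-! ### Transporting compatible submodules to leading blocks. -/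

section Comparison

universe u
variable {R : Type u} [CommRing R] {r m p : ℕ} [Fact p.Prime]

theorem isSpecial_of_forall_mul_mem (hR : HasFrobeniusCoordinates p R) {Q : Ideal R} (hr : 0 < r)
    {T : Matrix (Fin r) (Fin r) R} (h : ∀ x ∈ Q, ∀ i j, T i j * x ∈ idealFrobPow p Q) :
    IsSpecial p T Q := by
  refine ⟨Q • ⊤, isCompatible_iff.2 fun v hv => ?_, ?_⟩
  · rw [mem_frobPow_smul_top_iff hR]
    rw [mem_smul_top_iff] at hv
    intro i
    rw [Matrix.mulVec, dotProduct]
    exact Ideal.sum_mem _ fun j _ => h _ (hv j) i j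
  · ext x
    rw [mem_annihilator_quotient_iff]
    constructor
    · exact fun hx v => Submodule.smul_mem_smul hx trivial
    · intro hx
      simpa using (mem_smul_top_iff Q _).1 (hx fun _ => 1) ⟨0, hr⟩

/-- As e_last ∈ W, the quotient by W is unchanged on forgetting the last coordinate. Each vector of
W may be given last entry 0, and on such vectors the upper part of U acts as the block. -/
theorem isSpecial_leadingBlock (hR : HasFrobeniusCoordinates p R)
    {U : Matrix (Fin (m + 1)) (Fin (m + 1)) R} {W : Submodule R (Fin (m + 1) → R)}
    (hW : IsCompatible p U W) (hlast : Pi.single (Fin.last m) 1 ∈ W) :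
    IsSpecial p (leadingBlock U) (Module.annihilator R ((Fin (m + 1) → R) ⧸ W)) := by
  refine ⟨W.map (LinearMap.funLeft R R Fin.castSucc), isCompatible_iff.2 ?_, ?_⟩
  · rintro _ ⟨v, hv, rfl⟩
    have hv0 : v - v (Fin.last m) • Pi.single (Fin.last m) 1 ∈ W :=
      W.sub_mem hv (W.smul_mem _ hlast)
    have h1 := isCompatible_iff.1 hW _ hv0
    obtain ⟨ι, b, c, h⟩ := hR
    rw [h.mem_frobPow_iff] at h1 ⊢
    intro j
    refine ⟨_, h1 j, ?_⟩
    ext i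
    simp [leadingBlock, LinearMap.funLeft_apply, Matrix.mulVec, dotProduct, Fin.sum_univ_castSucc]
  · ext x
    rw [mem_annihilator_quotient_iff, mem_annihilator_quotient_iff]
    constructor
    · intro hx w
      refine ⟨x • Fin.snoc w 0, hx _, ?_⟩
      ext i
      simp [LinearMap.funLeft_apply]
    · intro hx v
      obtain ⟨w, hw, hwv⟩ := hx (fun i => v i.castSucc)
      have : x • v = w + (x * v (Fin.last m) - w (Fin.last m)) • Pi.single (Fin.last m) 1 := by
        ext i
        refine Fin.lastCases ?_ (fun i => ?_) i
        · simp
        · have := congrFun hwv i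
          simp only [LinearMap.funLeft_apply, Pi.smul_apply, smul_eq_mul] at this
          simp [this]
      rw [this]
      exact W.add_mem hw (W.smul_mem _ hlast)

section Comap

variable {Q : Ideal R} {W : Submodule R (Fin r → R)} {a : R} {U U₁ Z Y : Matrix (Fin r) (Fin r) R}
  {N L K : ℕ}

theorem mulVec_mem_frobPow_comap (hR : HasFrobeniusCoordinates p R) (hQ : Q.IsPrime)
    (hsat : ∀ s ∉ Q, ∀ w, s • w ∈ W → w ∈ W) (ha : a ∉ Q)
    (hZU : a ^ N • (Z.map (fun x => x ^ p) * U₁) = a ^ L • (U * Z)) {v : Fin r → R}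
    (hv : U *ᵥ (Z *ᵥ v) ∈ frobPow p W) : U₁ *ᵥ v ∈ frobPow p (W.comap Z.mulVecLin) := by
  rw [mem_frobPow_comap_iff hR]
  refine mem_frobPow_of_smul hR (a := a ^ N)
    (hsat _ fun h => ha (hQ.mem_of_pow_mem N h)) ?_
  rw [Matrix.mulVec_mulVec, ← Matrix.smul_mulVec, hZU, Matrix.smul_mulVec, ← Matrix.mulVec_mulVec]
  exact Submodule.smul_mem _ _ hv

theorem annihilator_quotient_comap (hQ : Q.IsPrime)
    (hann : Q = Module.annihilator R ((Fin r → R) ⧸ W)) (ha : a ∉ Q) (hZY : Z * Y = a ^ K • 1) :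
    Q = Module.annihilator R ((Fin r → R) ⧸ W.comap Z.mulVecLin) := by
  apply le_antisymm
  · intro x hx
    rw [hann, mem_annihilator_quotient_iff] at hx
    rw [mem_annihilator_quotient_iff]
    intro v
    rw [Submodule.mem_comap, map_smul]
    exact hx _
  · intro x hx
    rw [mem_annihilator_quotient_iff] at hx
    have hmem : x * a ^ K ∈ Q := by
      rw [hann, mem_annihilator_quotient_iff]
      intro v
      have := hx (Y *ᵥ v)
      rwa [Submodule.mem_comap, map_smul, Matrix.mulVecLin_apply, Matrix.mulVec_mulVec, hZY,
        Matrix.smul_mulVec, Matrix.one_mulVec, ← mul_smul] at this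
    exact (hQ.mem_or_mem hmem).resolve_right fun h => ha (hQ.mem_of_pow_mem K h)

end Comap

theorem MovesLastInto.mono {a : R} {X : GL (Fin (m + 1)) (Localization.Away a)}
    {N W : Submodule R (Fin (m + 1) → R)} (h : MovesLastInto a X N) (hNW : N ≤ W) :
    MovesLastInto a X W := by
  obtain ⟨v, hv, hXv⟩ := h
  exact ⟨v, Submodule.span_mono (Set.image_mono hNW) hv, hXv⟩

theorem isTransform_one (U : Matrix (Fin r) (Fin r) R) : IsTransform p U (1 : R) 1 U := by
  refine ⟨0, ?_⟩
  have h1 : (1 : Matrix (Fin r) (Fin r) (Localization.Away (1 : R))).map (fun x => x ^ p) = 1 :=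
    Matrix.map_one _ (zero_pow (Fact.out : p.Prime).ne_zero) (one_pow p)
  rw [inv_one, Units.val_one, h1]
  simp

variable [IsDomain R] [CharP R p] {P Q : Ideal R} {a : R}
  {U U₁ V : Matrix (Fin (m + 1)) (Fin (m + 1)) R} {W : Submodule R (Fin (m + 1) → R)}
  {X : GL (Fin (m + 1)) (Localization.Away a)}

theorem MovesLastInto.isSpecial_leadingBlock (hR : HasFrobeniusCoordinates p R) (hQ : Q.IsPrime)
    (hW : IsCompatible p U W) (hann : Q = Module.annihilator R ((Fin (m + 1) → R) ⧸ W))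
    (hsat : ∀ s ∉ Q, ∀ w, s • w ∈ W → w ∈ W) (ha : a ∉ Q) (hX : MovesLastInto a X W)
    (hU₁ : IsTransform p U a X U₁) : IsSpecial p (leadingBlock U₁) Q := by
  have ha0 : a ≠ 0 := fun h => ha (h ▸ Q.zero_mem)
  obtain ⟨N, K, Z, Y, hZ, hZY⟩ := exists_inverse_denominators ha0 X
  obtain ⟨L, hL⟩ := hU₁.pow_smul_mul_eq ha0 hZ
  obtain ⟨l, hl⟩ := hX.exists_pow_smul_mem ha0 hZ
  rw [annihilator_quotient_comap hQ hann ha hZY]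
  refine SpecialIdeals.isSpecial_leadingBlock hR (isCompatible_iff.2 fun v hv =>
    mulVec_mem_frobPow_comap hR hQ hsat ha hL (isCompatible_iff.1 hW _ hv)) ?_
  exact hsat _ (fun h => ha (hQ.mem_of_pow_mem l h)) _ hl

/-- U₁ sends the transported module enlarged by e_last into the Frobenius power of the unenlarged
one. If x ∉ Q killed the enlarged quotient, a multiple of U by an element outside Q would map R^α
into W^[p], and so would U, against `hUW`. -/
theorem KillsLastColumn.isSpecial_leadingBlock (hR : HasFrobeniusCoordinates p R)
    (hP : P.IsPrime) (hPQ : P ≤ Q) (hQ : Q.IsPrime)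
    (hW : IsCompatible p U W) (hann : Q = Module.annihilator R ((Fin (m + 1) → R) ⧸ W))
    (hsat : ∀ s ∉ Q, ∀ w, s • w ∈ W → w ∈ W) (hUW : ∃ v, U *ᵥ v ∉ frobPow p W)
    (hUV : ∀ v, (∀ i, (V *ᵥ v) i ∈ P) → U *ᵥ v ∈ frobPow p W)
    (ha : a ∉ Q) (hX : KillsLastColumn a X V P)
    (hU₁ : IsTransform p U a X U₁) : IsSpecial p (leadingBlock U₁) Q := by
  have ha0 : a ≠ 0 := fun h => ha (h ▸ Q.zero_mem)
  obtain ⟨N, K, Z, Y, hZ, hZY⟩ := exists_inverse_denominators ha0 X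
  obtain ⟨L, hL⟩ := hU₁.pow_smul_mul_eq ha0 hZ
  have hlast : U₁ *ᵥ Pi.single (Fin.last m) 1 ∈ frobPow p (W.comap Z.mulVecLin) :=
    mulVec_mem_frobPow_comap hR hQ hsat ha hL
      (hUV _ fun i => hX.mulVec_mem hP (fun h => ha (hPQ h)) hZ i)
  set W' := W.comap Z.mulVecLin ⊔ Submodule.span R {Pi.single (Fin.last m) 1}
  have hmem : ∀ v ∈ W', U₁ *ᵥ v ∈ frobPow p (W.comap Z.mulVecLin) := by
    intro v hv
    obtain ⟨w, hw, y, hy, rfl⟩ := Submodule.mem_sup.1 hv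
    obtain ⟨t, rfl⟩ := Submodule.mem_span_singleton.1 hy
    rw [Matrix.mulVec_add, Matrix.mulVec_smul]
    exact Submodule.add_mem _ (mulVec_mem_frobPow_comap hR hQ hsat ha hL
      (isCompatible_iff.1 hW _ hw)) (Submodule.smul_mem _ _ hlast)
  have hannW' : Q = Module.annihilator R ((Fin (m + 1) → R) ⧸ W') := by
    apply le_antisymm
    · intro x hx
      rw [annihilator_quotient_comap hQ hann ha hZY, mem_annihilator_quotient_iff] at hx
      rw [mem_annihilator_quotient_iff]
      exact fun v => Submodule.mem_sup_left (hx v)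
    · intro x hx
      by_contra hxQ
      obtain ⟨v, hv⟩ := hUW
      rw [mem_annihilator_quotient_iff] at hx
      apply hv
      have hapow : ∀ n : ℕ, a ^ n ∉ Q := fun n h => ha (hQ.mem_of_pow_mem n h)
      refine mem_frobPow_of_smul hR (a := x * (a ^ L * a ^ K))
        (hsat _ (hQ.mul_notMem hxQ (hQ.mul_notMem (hapow L) (hapow K)))) ?_
      have h1 := (mem_frobPow_comap_iff hR Z).1 (hmem _ (hx (Y *ᵥ v)))
      have h2 : (x * (a ^ L * a ^ K)) • U *ᵥ v =
          a ^ N • Z.map (fun x => x ^ p) *ᵥ (U₁ *ᵥ (x • Y *ᵥ v)) := by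
        rw [Matrix.mulVec_mulVec, ← Matrix.smul_mulVec (a ^ N), hL, Matrix.mulVec_smul,
          Matrix.mulVec_mulVec, Matrix.smul_mul, Matrix.mul_assoc, hZY, Matrix.mul_smul,
          Matrix.mul_one, Matrix.smul_mulVec, Matrix.smul_mulVec, mul_smul, mul_smul]
      rw [h2]
      exact Submodule.smul_mem _ _ h1
  rw [hannW']
  refine SpecialIdeals.isSpecial_leadingBlock hR (isCompatible_iff.2 fun v hv =>
    frobPow_mono p le_sup_left (hmem v hv)) ?_
  exact Submodule.mem_sup_right (Submodule.mem_span_singleton_self _)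

/-- Triples of types A and B are only guaranteed with a ∉ P, possibly a ∈ Q; this supplies one with
a ∉ Q. Either W has a vector with an entry outside Q, or W ⊆ QR^α, whence U·Q ⊆ Q^[p] entrywise and
X = 1 works. -/
theorem exists_isSpecial_leadingBlock (hR : HasFrobeniusCoordinates p R) (hm : 0 < m)
    (hQ : Q.IsPrime) (hW : IsCompatible p U W)
    (hann : Q = Module.annihilator R ((Fin (m + 1) → R) ⧸ W))
    (hsat : ∀ s ∉ Q, ∀ w, s • w ∈ W → w ∈ W) :
    ∃ (a : R) (X : GL (Fin (m + 1)) (Localization.Away a))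
      (U₁ : Matrix (Fin (m + 1)) (Fin (m + 1)) R),
      a ∉ Q ∧ IsTransform p U a X U₁ ∧ IsSpecial p (leadingBlock U₁) Q := by
  by_cases hWQ : ∃ v ∈ W, ∃ i, v i ∉ Q
  · obtain ⟨v, hv, i, hi⟩ := hWQ
    obtain ⟨X, hX⟩ := exists_movesLastInto (a := v i) rfl hv
    obtain ⟨U₁, hU₁⟩ := exists_isTransform p U (v i) X
    exact ⟨v i, X, U₁, hi, hU₁, hX.isSpecial_leadingBlock hR hQ hW hann hsat hi hU₁⟩
  · push Not at hWQ
    refine ⟨1, 1, U, hQ.one_notMem, isTransform_one U, isSpecial_of_forall_mul_mem hR hm ?_⟩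
    intro x hx i j
    have hxW : x • Pi.single j.castSucc 1 ∈ W := by
      rw [hann, mem_annihilator_quotient_iff] at hx
      exact hx _
    have h1 := frobPow_mono p (fun v hv => (mem_smul_top_iff Q v).2 (hWQ v hv))
      (isCompatible_iff.1 hW _ hxW)
    have h2 := (mem_frobPow_smul_top_iff hR).1 h1 i.castSucc
    rw [Matrix.mulVec_smul] at h2
    simpa [leadingBlock, mul_comm] using h2

end Comparison

/-! ### The case distinctions of the theorem. -/

section Alternatives

universe u
/-- The entries of `U` lie in `P^[p] : P` when `P R^r` is compatible with `U`. -/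
theorem IsCompatible.mul_mem_idealFrobPow {R : Type u} [CommRing R] {r p : ℕ}
    [Fact p.Prime] {P : Ideal R} {U : Matrix (Fin r) (Fin r) R}
    (hR : HasFrobeniusCoordinates p R) (h : IsCompatible p U (P • ⊤)) (i j : Fin r) {x : R}
    (hx : x ∈ P) : U i j * x ∈ idealFrobPow p P := by
  have h1 := isCompatible_iff.1 h (x • Pi.single j 1) (Submodule.smul_mem_smul hx trivial)
  rw [mem_frobPow_smul_top_iff hR] at h1
  have := h1 i
  rw [Matrix.mulVec_smul] at this
  simpa [mul_comm] using this

/-- If `P R^r` is compatible with `U`, then `U` is generically a multiple of one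
`g` modulo `P^[p]`. -/
theorem exists_generator {R : Type u} [CommRing R] [IsNoetherianRing R] {m p : ℕ}
    [Fact p.Prime] {P : Ideal R} {U : Matrix (Fin (m + 1)) (Fin (m + 1)) R}
    (hR : HasFrobeniusCoordinates p R) (hgen : HasFrobeniusGenerators p R)
    (hP : P.IsPrime) (hU : IsCompatible p U (P • ⊤)) :
    ∃ a₁ g : R, a₁ ∉ P ∧ (∀ x ∈ P, g * x ∈ idealFrobPow p P) ∧ g ∉ idealFrobPow p P ∧
      ∀ μ ≥ 1, ∃ V : Matrix (Fin (m + 1)) (Fin (m + 1)) R,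
        ∀ i j, a₁ ^ μ * U i j - g * V i j ∈ idealFrobPow p P := by
  obtain ⟨g, hg, hgf⟩ := hgen P hP
  obtain ⟨a₁, ha₁, hv⟩ := exists_common_multiplier hP
    (fun ij : Fin (m + 1) × Fin (m + 1) => U ij.1 ij.2) g Finset.univ
    fun ij _ => hgf _ fun x hx => hU.mul_mem_idealFrobPow hR ij.1 ij.2 hx
  choose v hv using fun ij => hv ij (Finset.mem_univ ij)
  refine ⟨a₁, g, ha₁, hg, generator_notMem_idealFrobPow hP
    (fun a x ha hx => mem_idealFrobPow_of_mul_mem hR hP ha hx) hgf, fun μ hμ =>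
    -- One factor a₁ is consumed by the common multiplier, hence the bound μ ≥ 1.
    ⟨Matrix.of fun i j => a₁ ^ (μ - 1) * v (i, j), fun i j => ?_⟩⟩
  obtain ⟨ν, rfl⟩ := Nat.exists_eq_add_of_le' hμ
  convert Ideal.mul_mem_left _ (a₁ ^ ν) (hv (i, j)) using 1
  simp only [Matrix.of_apply, Nat.add_sub_cancel]
  ring

variable {R : Type u} [CommRing R] [IsDomain R] [IsNoetherianRing R] {m p : ℕ} [Fact p.Prime]
  [CharP R p] {P Q : Ideal R} {U : Matrix (Fin (m + 1)) (Fin (m + 1)) R}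

theorem MinimallyContains.alternatives_of_lt (hR : HasFrobeniusCoordinates p R) {s : ℕ}
    {M : Matrix (Fin (m + 1)) (Fin s) R}
    (hM : LinearMap.range M.mulVecLin = starClosure p U (P • ⊤))
    (hlt : P • ⊤ < LinearMap.range M.mulVecLin) (h : MinimallyContains p U P Q) :
    ((∀ i j, M i j ∈ Q) ∧ ∃ i j, M i j ∉ P ∧ Q ∈ (annStar p U P (M i j)).minimalPrimes) ∨
      ((∃ i j, M i j ∉ Q) ∧ ∀ i j, M i j ∉ Q →
        (∃ X U₁, MovesLastInto (M i j) X (LinearMap.range M.mulVecLin) ∧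
          IsTransform p U (M i j) X U₁) ∧
        (∀ X U₁, MovesLastInto (M i j) X (LinearMap.range M.mulVecLin) →
          IsTransform p U (M i j) X U₁ → IsSpecialPrime p (leadingBlock U₁) Q)) := by
  by_cases hMQ : ∀ i j, M i j ∈ Q
  · refine Or.inl ⟨hMQ, ?_⟩
    have hMP : ∃ i j, M i j ∉ P := by
      by_contra! hcon
      refine hlt.not_ge ?_
      rintro _ ⟨v, rfl⟩
      rw [mem_smul_top_iff]
      intro i
      rw [Matrix.mulVecLin_apply, Matrix.mulVec, dotProduct]
      exact Ideal.sum_mem _ fun j _ => Ideal.mul_mem_right _ _ (hcon i j)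
    obtain ⟨i, j, hij⟩ := hMP
    exact ⟨i, j, hij, h.mem_minimalPrimes_annStar hR (hMQ i j) hij⟩
  · push Not at hMQ
    refine Or.inr ⟨hMQ, fun i j hij => ⟨?_, fun X U₁ hX hU₁ => ⟨h.1.1, ?_⟩⟩⟩
    · obtain ⟨X, hX⟩ := exists_movesLastInto (a := M i j) (v := M *ᵥ Pi.single j 1) (i := i)
        (by simp) (N := LinearMap.range M.mulVecLin) ⟨Pi.single j 1, rfl⟩
      obtain ⟨U₁, hU₁⟩ := exists_isTransform p U (M i j) X
      exact ⟨X, U₁, hX, hU₁⟩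
    · obtain ⟨W, hW, hann, hsat⟩ := h.1.exists_saturated hR
      refine (hX.mono ?_).isSpecial_leadingBlock hR h.1.1 hW hann hsat hij hU₁
      rw [hM]
      exact starClosure_le ((smul_top_le_iff _ _).2 (hann ▸ h.2.1.le)) hW

theorem MinimallyContains.alternatives_of_congr (hR : HasFrobeniusCoordinates p R) (hP : P.IsPrime)
    (hK : ¬ stableImage p U ≤ P • (⊤ : Submodule R (Fin (m + 1) → R))) {b g : R} (hb : b ∉ P)
    (hg : ∀ x ∈ P, g * x ∈ idealFrobPow p P) {V : Matrix (Fin (m + 1)) (Fin (m + 1)) R}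
    (hV : ∀ i j, b * U i j - g * V i j ∈ idealFrobPow p P) (h : MinimallyContains p U P Q) :
    (V.det ∈ P ∧
      (∃ a X U₁, a ∉ Q ∧ IsTransform p U a X U₁ ∧ IsSpecialPrime p (leadingBlock U₁) Q) ∧
      (∃ a X U₁, a ∉ P ∧ KillsLastColumn a X V P ∧ IsTransform p U a X U₁) ∧
      (∃ a X U₁, a ∉ P ∧ MovesLastInto a X (stableImage p U) ∧ IsTransform p U a X U₁) ∧
      ((∀ a X U₁, a ∉ Q → KillsLastColumn a X V P → IsTransform p U a X U₁ →
          IsSpecialPrime p (leadingBlock U₁) Q) ∨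
        (∀ a X U₁, a ∉ Q → MovesLastInto a X (stableImage p U) → IsTransform p U a X U₁ →
          IsSpecialPrime p (leadingBlock U₁) Q)) ∧
      (∀ a ∈ Q, a ∉ P → Q ∈ (annStar p U P a).minimalPrimes)) ∨
    (V.det ∈ Q ∧ V.det ∉ P ∧ Q ∈ (annStar p U P V.det).minimalPrimes) ∨
    (V.det ∉ Q ∧ IsSpecialPrime p !![g] Q) := by
  have hQ : Q.IsPrime := h.1.1
  obtain ⟨W, hW, hann, hsat⟩ := h.1.exists_saturated hR
  have hQW : Q • ⊤ ≤ W := (smul_top_le_iff _ _).2 hann.le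
  have hPW : P • ⊤ ≤ W := (Submodule.smul_mono_left h.2.1.le).trans hQW
  have hcongr : ∀ v i, b * (U *ᵥ v) i - g * (V *ᵥ v) i ∈ idealFrobPow p P := by
    intro v i
    have : b * (U *ᵥ v) i - g * (V *ᵥ v) i = ∑ j, (b * U i j - g * V i j) * v j := by
      simp [Matrix.mulVec, dotProduct, Finset.mul_sum, sub_mul, mul_assoc]
    rw [this]
    exact Ideal.sum_mem _ fun j _ => Ideal.mul_mem_right _ _ (hV i j)
  have hUP : ∀ v, (∀ i, (V *ᵥ v) i ∈ P) → ∀ i, (U *ᵥ v) i ∈ idealFrobPow p P := by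
    intro v hv i
    refine mem_idealFrobPow_of_mul_mem hR hP hb ?_
    have := Ideal.add_mem _ (hcongr v i) (hg _ (hv i))
    rwa [sub_add_cancel] at this
  by_cases hdQ : V.det ∈ Q
  · by_cases hdP : V.det ∈ P
    · refine Or.inl ⟨hdP, ?_, ?_, ?_, ?_, fun a haQ haP => h.mem_minimalPrimes_annStar hR haQ haP⟩
      · have hm : 0 < m := by
          -- For α = 1, det V ∈ P would put the image of U in P^[p], hence the stable image in P,
          -- contrary to `hK`.
          rcases Nat.eq_zero_or_pos m with rfl | hm
          · refine absurd (stableImage_le fun v => ?_) hK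
            rw [mem_frobPow_smul_top_iff hR]
            refine hUP v fun i => ?_
            have hi : (V *ᵥ v) i = V.det * v 0 := by
              obtain rfl : i = 0 := Fin.ext (by omega)
              simp [Matrix.mulVec, dotProduct]
            rw [hi]
            exact Ideal.mul_mem_right _ _ hdP
          · exact hm
        obtain ⟨a, X, U₁, ha, hU₁, hs⟩ :=
          exists_isSpecial_leadingBlock (U := U) hR hm hQ hW hann hsat
        exact ⟨a, X, U₁, ha, hU₁, hQ, hs⟩
      · obtain ⟨v, ⟨i, hi⟩, hv⟩ := exists_mulVec_mem_of_det_mem hP hdP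
        obtain ⟨X, hX⟩ := exists_killsLastColumn (a := v i) rfl hv
        obtain ⟨U₁, hU₁⟩ := exists_isTransform p U (v i) X
        exact ⟨v i, X, U₁, hi, hX, hU₁⟩
      · obtain ⟨v, hv, hvP⟩ := SetLike.not_le_iff_exists.1 hK
        rw [mem_smul_top_iff, not_forall] at hvP
        obtain ⟨i, hi⟩ := hvP
        obtain ⟨X, hX⟩ := exists_movesLastInto (a := v i) rfl hv
        obtain ⟨U₁, hU₁⟩ := exists_isTransform p U (v i) X
        exact ⟨v i, X, U₁, hi, hX, hU₁⟩
      -- This depends on Q alone, so one type serves all triples with a ∉ Q at once.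
      · by_cases hUW : ∃ v, U *ᵥ v ∉ frobPow p W
        · refine Or.inl fun a X U₁ ha hX hU₁ => ⟨hQ, ?_⟩
          refine hX.isSpecial_leadingBlock hR hP h.2.1.le hQ hW hann hsat hUW (fun v hv => ?_)
            ha hU₁
          exact frobPow_mono p hPW ((mem_frobPow_smul_top_iff hR).2 (hUP v hv))
        · push Not at hUW
          exact Or.inr fun a X U₁ ha hX hU₁ => ⟨hQ,
            (hX.mono (stableImage_le hUW)).isSpecial_leadingBlock hR hQ hW hann hsat ha hU₁⟩
    · exact Or.inr (Or.inl ⟨hdQ, hdP, h.mem_minimalPrimes_annStar hR hdQ hdP⟩)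
  · refine Or.inr (Or.inr ⟨hdQ, hQ, isSpecial_of_forall_mul_mem hR one_pos fun x hx i j => ?_⟩)
    obtain rfl : i = 0 := Subsingleton.elim _ _
    obtain rfl : j = 0 := Subsingleton.elim _ _
    refine mem_idealFrobPow_of_mul_mem hR hQ hdQ ?_
    rw [hann]
    refine mem_idealFrobPow_annihilator hR fun v => ?_
    -- With w = adj(V)·xv ∈ W: gVw = det V·g·x·v is congruent to bUw modulo P^[p], so it lies in
    -- W^[p].
    have hw : V.adjugate *ᵥ (x • v) ∈ W := by
      rw [Matrix.mulVec_smul]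
      exact hQW (Submodule.smul_mem_smul hx trivial)
    have h1 : b • U *ᵥ (V.adjugate *ᵥ (x • v)) - g • V *ᵥ (V.adjugate *ᵥ (x • v)) ∈ frobPow p W :=
      frobPow_mono p hPW ((mem_frobPow_smul_top_iff hR).2 fun i => hcongr _ i)
    have h2 := Submodule.sub_mem _ (Submodule.smul_mem _ b (isCompatible_iff.1 hW _ hw)) h1
    rw [sub_sub_cancel, Matrix.mulVec_mulVec, Matrix.mul_adjugate, Matrix.smul_mulVec,
      Matrix.one_mulVec, smul_smul, smul_smul] at h2
    convert h2 using 2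
    simp
    ring

end Alternatives

end SpecialIdeals

theorem theorem4p13 {p n m s : ℕ} [Fact p.Prime] {k : Type*} [Field k] [CharP k p]
    (U : Matrix (Fin (m + 1)) (Fin (m + 1)) (MvPolynomial (Fin n) k))
    (P : Ideal (MvPolynomial (Fin n) k))
    (hP : SpecialIdeals.IsSpecialPrime p U P)
    (hK : ¬ SpecialIdeals.stableImage p U ≤
      P • (⊤ : Submodule (MvPolynomial (Fin n) k) (Fin (m + 1) → MvPolynomial (Fin n) k)))
    (M : Matrix (Fin (m + 1)) (Fin s) (MvPolynomial (Fin n) k))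
    (hM : LinearMap.range M.mulVecLin = SpecialIdeals.starClosure p U (P • ⊤)) :
    -- `PR^α` is strictly contained in the image of `M`
    (P • ⊤ < LinearMap.range M.mulVecLin →
      ∀ Q : Ideal (MvPolynomial (Fin n) k), SpecialIdeals.MinimallyContains p U P Q →
        ((∀ i j, M i j ∈ Q) ∧
          ∃ i j, M i j ∉ P ∧ Q ∈ (SpecialIdeals.annStar p U P (M i j)).minimalPrimes) ∨
        ((∃ i j, M i j ∉ Q) ∧
          ∀ i j, M i j ∉ Q →
            (∃ X U₁, SpecialIdeals.MovesLastInto (M i j) X (LinearMap.range M.mulVecLin) ∧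
              SpecialIdeals.IsTransform p U (M i j) X U₁) ∧
            (∀ X U₁, SpecialIdeals.MovesLastInto (M i j) X (LinearMap.range M.mulVecLin) →
              SpecialIdeals.IsTransform p U (M i j) X U₁ →
              SpecialIdeals.IsSpecialPrime p (SpecialIdeals.leadingBlock U₁) Q))) ∧
    -- `PR^α` is the image of `M`
    (P • ⊤ = LinearMap.range M.mulVecLin →
      ∃ (a₁ g : MvPolynomial (Fin n) k) (μ₀ : ℕ),
        a₁ ∉ P ∧
        (∀ x ∈ P, g * x ∈ SpecialIdeals.idealFrobPow p P) ∧
        g ∉ SpecialIdeals.idealFrobPow p P ∧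
        (∀ μ ≥ μ₀, ∃ V : Matrix (Fin (m + 1)) (Fin (m + 1)) (MvPolynomial (Fin n) k),
          ∀ i j, a₁ ^ μ * U i j - g * V i j ∈ SpecialIdeals.idealFrobPow p P) ∧
        ∀ μ ≥ μ₀, ∀ V : Matrix (Fin (m + 1)) (Fin (m + 1)) (MvPolynomial (Fin n) k),
          (∀ i j, a₁ ^ μ * U i j - g * V i j ∈ SpecialIdeals.idealFrobPow p P) →
          ∀ Q : Ideal (MvPolynomial (Fin n) k), SpecialIdeals.MinimallyContains p U P Q →
            (V.det ∈ P ∧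
              (∃ a X U₁, a ∉ Q ∧ SpecialIdeals.IsTransform p U a X U₁ ∧
                SpecialIdeals.IsSpecialPrime p (SpecialIdeals.leadingBlock U₁) Q) ∧
              (∃ a X U₁, a ∉ P ∧ SpecialIdeals.KillsLastColumn a X V P ∧
                SpecialIdeals.IsTransform p U a X U₁) ∧
              (∃ a X U₁, a ∉ P ∧
                SpecialIdeals.MovesLastInto a X (SpecialIdeals.stableImage p U) ∧
                SpecialIdeals.IsTransform p U a X U₁) ∧
              ((∀ a X U₁, a ∉ Q → SpecialIdeals.KillsLastColumn a X V P →
                  SpecialIdeals.IsTransform p U a X U₁ →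
                  SpecialIdeals.IsSpecialPrime p (SpecialIdeals.leadingBlock U₁) Q) ∨
                (∀ a X U₁, a ∉ Q →
                  SpecialIdeals.MovesLastInto a X (SpecialIdeals.stableImage p U) →
                  SpecialIdeals.IsTransform p U a X U₁ →
                  SpecialIdeals.IsSpecialPrime p (SpecialIdeals.leadingBlock U₁) Q)) ∧
              (∀ a ∈ Q, a ∉ P → Q ∈ (SpecialIdeals.annStar p U P a).minimalPrimes)) ∨
            (V.det ∈ Q ∧ V.det ∉ P ∧
              Q ∈ (SpecialIdeals.annStar p U P V.det).minimalPrimes) ∨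
            (V.det ∉ Q ∧ SpecialIdeals.IsSpecialPrime p !![g] Q)) := by
  have hF := SpecialIdeals.mvPolynomial_frobenius p k n
  refine ⟨fun hlt Q hQ => SpecialIdeals.MinimallyContains.alternatives_of_lt hF.1 hM hlt hQ,
    fun heq => ?_⟩
  have hU : SpecialIdeals.IsCompatible p U (P • ⊤) := by
    rw [heq, hM]
    exact SpecialIdeals.isCompatible_starClosure hF.1 _
  obtain ⟨a₁, g, ha₁, hg, hgP, hV⟩ := SpecialIdeals.exists_generator hF.1 hF.2 hP.1 hU
  exact ⟨a₁, g, 1, ha₁, hg, hgP, hV, fun μ _ V hV Q hQ =>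
    SpecialIdeals.MinimallyContains.alternatives_of_congr hF.1 hP.1 hK
      (fun h => ha₁ (hP.1.mem_of_pow_mem μ h)) hg hV hQ⟩
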